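/- Let $K$ be an algebraically closed field of characteristic $0$, let $0\neq\alpha\in K$ and choose $\beta\in K$ with $\beta^2=\alpha$. Let $\Lambda=\mathcal{D}_4(\alpha,-\alpha)$ be the unital associative $K$-algebra generated by $x_{ij}=-x_{ji}$ $(1\le i\ne j\le 4)$ with relations $x_{ij}^2=\alpha$, $x_{ij}x_{kl}=x_{kl}x_{ij}$ for $i,j,k,l$ distinct, and $x_{ij}x_{jk}+x_{jk}x_{ki}+x_{ki}x_{ij}=-\alpha$ for $i,j,k$ distinct. Let $J=\mathrm{rad}\,\Lambda$ be its Jacobson radical. For $\sigma\in\mathbb{S}_4$ let $\rho_\sigma:\Lambda\to K$ be the character with $\rho_\sigma(x_{ij})=\beta$ if $\sigma(i)<\sigma(j)$ and $\rho_\sigma(x_{ij})=-\beta$ otherwise. Put $t_1=(1\,3)$, $t_2=(1\,4)$, $t_3=(2\,4)$. (1) There is a complete system of primitive orthogonal idempotents $(e_\sigma)_{\sigma\in\mathbb{S}_4}$ of $\Lambda$ with $\rho_\sigma(e_\tau)=\delta_{\sigma,\tau}$. (2) Let $(e_\sigma)$ be any such system, let $\Gamma_\sigma=e_\sigma\Lambda$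 be the corresponding indecomposable projective right $\Lambda$-modules, and let $\mathrm{gr}\,\Gamma_\sigma=\bigoplus_{r\ge0}e_\sigma J^r/e_\sigma J^{r+1}$. Then one can choose elements $a_{\sigma,i}\in e_\sigma Je_{t_i\sigma}$ $(\sigma\in\mathbb{S}_4,\ i=1,2,3)$ such that, for all $\sigma,\tau$, the classes of those $a_{\sigma,i}$ with $t_i\sigma=\tau$ form a basis of $e_\sigma(J/J^2)e_\tau$ (so that $a_{\sigma,i}$ is the image of an arrow $\sigma\to t_i\sigma$ of the quiver of $\Lambda$), and such that the following holds for every $\sigma$. For a word $w=i_1\cdots i_k$ in the letters $1,2,3$ let $[w]_\sigma$ be the class in $e_\sigma J^k/e_\sigma J^{k+1}$ of the path product $a_{\sigma,i_1}\,a_{t_{i_1}\sigma,i_2}\cdots a_{t_{i_{k-1}}\cdots t_{i_1}\sigma,\,i_k}$ (of $e_\sigma$ if $k=0$). Then $\mathrm{gr}\,\Gamma_\sigma$ carries a bilinear multiplication with $[u]_\sigma\cdot[v]_\sigma=[uv]_\sigma$ for all words $u,v$, and with this multiplication $$K\langle s_1,s_2,s_3\rangle/\bigl(s_1^2,\ s_2^2,\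 s_3^2,\ s_1s_3-s_3s_1,\ s_1s_2s_1-s_2s_1s_2,\ s_3s_2s_3-s_2s_3s_2\bigr)\;\cong\;\mathrm{gr}\,\Gamma_\sigma,\qquad s_{i_1}\cdots s_{i_k}\mapsto[i_1\cdots i_k]_\sigma,$$ is an isomorphism of $K$-algebras. (3) The algebra on the left is isomorphic, through $s_i\mapsto u_i$, to the nil-Coxeter algebra of $\mathbb{S}_4$, that is, the algebra generated by $u_1,u_2,u_3$, one for each simple transposition $(i\;\,i{+}1)$, with relations $u_i^2=0$ and the braid relations of $\mathbb{S}_4$. -/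

import Mathlib

open scoped DirectSum

/-! ### Deformed Fomin-Kirillov algebras -/

/-- Index set of the generators `x_{ij}`, `i ≠ j`. -/
abbrev OffDiag (n : ℕ) : Type := {p : Fin n × Fin n // p.1 ≠ p.2}

/-- The free generator attached to the ordered pair `(i, j)`. -/
def freeX (K : Type*) [Field K] {n : ℕ} (i j : Fin n) (h : i ≠ j) : FreeAlgebra K (OffDiag n) :=
  FreeAlgebra.ι K ⟨(i, j), h⟩

/-- Defining relations of the deformed Fomin-Kirillov algebra `𝒟ₙ(α₁, α₂)`. -/
inductive DFKRel (K : Type*) [Field K] (n : ℕ) (α₁ α₂ : K) :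
    FreeAlgebra K (OffDiag n) → FreeAlgebra K (OffDiag n) → Prop
  | antisymm (i j : Fin n) (h : i ≠ j) :
      DFKRel K n α₁ α₂ (freeX K i j h) (-freeX K j i h.symm)
  | sq (i j : Fin n) (h : i ≠ j) :
      DFKRel K n α₁ α₂ (freeX K i j h * freeX K i j h) (algebraMap K _ α₁)
  | comm (i j k l : Fin n) (hij : i ≠ j) (hkl : k ≠ l)
      (hik : i ≠ k) (hil : i ≠ l) (hjk : j ≠ k) (hjl : j ≠ l) :
      DFKRel K n α₁ α₂ (freeX K i j hij * freeX K k l hkl) (freeX K k l hkl * freeX K i j hij)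
  | triangle (i j k : Fin n) (hij : i ≠ j) (hjk : j ≠ k) (hki : k ≠ i) :
      DFKRel K n α₁ α₂
        (freeX K i j hij * freeX K j k hjk + freeX K j k hjk * freeX K k i hki
          + freeX K k i hki * freeX K i j hij)
        (algebraMap K _ α₂)

/-- The deformed Fomin-Kirillov algebra `𝒟ₙ(α₁, α₂)`. -/
def DFK (K : Type*) [Field K] (n : ℕ) (α₁ α₂ : K) : Type _ := RingQuot (DFKRel K n α₁ α₂)

noncomputable instance (K : Type*) [Field K] (n : ℕ) (α₁ α₂ : K) : Ring (DFK K n α₁ α₂) :=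
  inferInstanceAs (Ring (RingQuot (DFKRel K n α₁ α₂)))

noncomputable instance (K : Type*) [Field K] (n : ℕ) (α₁ α₂ : K) : Algebra K (DFK K n α₁ α₂) :=
  inferInstanceAs (Algebra K (RingQuot (DFKRel K n α₁ α₂)))

/-- The value `±β` of the character `ρ_σ` at the generator `x_{ij}`. -/
def rhoGen {K : Type*} [Field K] {n : ℕ} (β : K) (σ : Equiv.Perm (Fin n)) (p : OffDiag n) : K :=
  if σ p.1.1 < σ p.1.2 then β else -β

theorem rhoGen_rel {K : Type*} [Field K] {n : ℕ} {α β : K} (hβ : β ^ 2 = α)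
    (σ : Equiv.Perm (Fin n)) ⦃x y : FreeAlgebra K (OffDiag n)⦄ (h : DFKRel K n α (-α) x y) :
    FreeAlgebra.lift K (rhoGen β σ) x = FreeAlgebra.lift K (rhoGen β σ) y := by
  subst hβ
  have key : ∀ i j : Fin n, i ≠ j → (σ i < σ j ∧ ¬ σ j < σ i) ∨ (σ j < σ i ∧ ¬ σ i < σ j) := by
    intro i j hij
    have h0 : σ i ≠ σ j := fun h => hij (σ.injective h)
    rcases lt_or_gt_of_ne h0 with h1 | h1
    · exact Or.inl ⟨h1, h1.asymm⟩
    · exact Or.inr ⟨h1, h1.asymm⟩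
  cases h with
  | antisymm i j h =>
    rcases key i j h with ⟨h1, h2⟩ | ⟨h1, h2⟩ <;> simp [freeX, rhoGen, h1, h2]
  | sq i j h =>
    rcases key i j h with ⟨h1, h2⟩ | ⟨h1, h2⟩ <;> simp [freeX, rhoGen, h1, h2, sq]
  | comm i j k l =>
    simp [freeX, rhoGen, mul_comm]
  | triangle i j k hij hjk hki =>
    rcases key i j hij with ⟨h1, h1'⟩ | ⟨h1, h1'⟩ <;>
    rcases key j k hjk with ⟨h2, h2'⟩ | ⟨h2, h2'⟩ <;>
    rcases key k i hki with ⟨h3, h3'⟩ | ⟨h3, h3'⟩ <;>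
    first
      | exact absurd ((h1.trans h2).trans h3) (lt_irrefl _)
      | exact absurd ((h1.trans h3).trans h2) (lt_irrefl _)
      | (simp [freeX, rhoGen, h1, h1', h2, h2', h3, h3']; try ring)

/-- The one-dimensional representation `ρ_σ` of `𝒟ₙ(α, -α)`, for a chosen square root `β` of `α`:
`ρ_σ(x_{ij}) = β` if `σ(i) < σ(j)` and `ρ_σ(x_{ij}) = -β` if `σ(i) > σ(j)`. -/
noncomputable def rho {K : Type*} [Field K] {n : ℕ} {α β : K} (hβ : β ^ 2 = α)
    (σ : Equiv.Perm (Fin n)) : DFK K n α (-α) →ₐ[K] K :=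
  RingQuot.liftAlgHom K ⟨FreeAlgebra.lift K (rhoGen β σ), rhoGen_rel hβ σ⟩

/-! ### Presenting `𝒟₄(α, -α)` by its quiver -/

/-- The non-simple transpositions `t₁ = (1 3)`, `t₂ = (1 4)`, `t₃ = (2 4)` of `𝕊₄`
(letters and indices are counted from `0` here). -/
def nonSimple : Fin 3 → Equiv.Perm (Fin 4) :=
  ![Equiv.swap 0 2, Equiv.swap 0 3, Equiv.swap 1 3]

/-- An idempotent is primitive if it is nonzero and not a sum of two nonzero orthogonal
idempotents, that is, the right module it generates is indecomposable. -/
def IsPrimitiveIdempotent {A : Type*} [Ring A] (e : A) : Prop :=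
  IsIdempotentElem e ∧ e ≠ 0 ∧
    ∀ f g : A, IsIdempotentElem f → IsIdempotentElem g → f * g = 0 → g * f = 0 → e = f + g →
      f = 0 ∨ g = 0

/-- A complete system of primitive orthogonal idempotents `e_σ` of `Λ = 𝒟₄(α, -α)`, where
`e_σ` belongs to the simple module `ρ_σ`. Thus `e_σ Λ` is the indecomposable projective right
`Λ`-module with top `ρ_σ`. -/
structure VertexSystem {K : Type*} [Field K] {α β : K} (hβ : β ^ 2 = α) where
  e : Equiv.Perm (Fin 4) → DFK K 4 α (-α)
  complete : CompleteOrthogonalIdempotents e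
  primitive : ∀ σ, IsPrimitiveIdempotent (e σ)
  rho_e : ∀ σ τ, rho hβ σ (e τ) = if σ = τ then 1 else 0

/-- Images in `Λ` of the arrows `α(σ; tᵢσ) : σ → tᵢσ` of the quiver of `Λ` under a Gabriel
morphism `KQ_Λ → Λ`: the image of `α(σ; tᵢσ)` lies in `e_σ (rad Λ) e_{tᵢσ}`, and for all `σ, τ`
the images of the arrows `σ → τ` (there is at most one) form a basis of
`e_σ (rad Λ / rad² Λ) e_τ`. -/
structure ArrowSystem {K : Type*} [Field K] {α β : K} {hβ : β ^ 2 = α}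
    (V : VertexSystem hβ) where
  a : Equiv.Perm (Fin 4) → Fin 3 → DFK K 4 α (-α)
  mem_rad : ∀ σ i, a σ i ∈ Ring.jacobson (DFK K 4 α (-α))
  left_e : ∀ σ i, V.e σ * a σ i = a σ i
  right_e : ∀ σ i, a σ i * V.e (nonSimple i * σ) = a σ i
  notMem_rad_sq : ∀ σ i, a σ i ∉ Ring.jacobson (DFK K 4 α (-α)) ^ 2
  spans : ∀ σ τ, ∀ x ∈ Ring.jacobson (DFK K 4 α (-α)),
    V.e σ * x * V.e τ ∈ Submodule.span K {y | ∃ i, nonSimple i * σ = τ ∧ y = a σ i} ⊔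
      (Ring.jacobson (DFK K 4 α (-α)) ^ 2).restrictScalars K

/-- The radical filtration `Γ_σ (rad Λ)^r = e_σ (rad Λ)^r` of the right module `Γ_σ = e_σ Λ`. -/
noncomputable def radFil {K : Type*} [Field K] {α β : K} {hβ : β ^ 2 = α} (V : VertexSystem hβ)
    (σ : Equiv.Perm (Fin 4)) (r : ℕ) : Submodule K (DFK K 4 α (-α)) :=
  Submodule.map (LinearMap.mulLeft K (V.e σ))
    ((Ring.jacobson (DFK K 4 α (-α)) ^ r).restrictScalars K)

/-- The homogeneous component `Γ_σ (rad Λ)^r / Γ_σ (rad Λ)^{r+1}` of `gr Γ_σ`. -/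
abbrev GrPiece {K : Type*} [Field K] {α β : K} {hβ : β ^ 2 = α} (V : VertexSystem hβ)
    (σ : Equiv.Perm (Fin 4)) (r : ℕ) : Type _ :=
  ↥(radFil V σ r) ⧸ (radFil V σ (r + 1)).submoduleOf (radFil V σ r)

/-- The space `gr Γ_σ` associated with the radical filtration of `Γ_σ = e_σ Λ`. -/
abbrev GrGamma {K : Type*} [Field K] {α β : K} {hβ : β ^ 2 = α} (V : VertexSystem hβ)
    (σ : Equiv.Perm (Fin 4)) : Type _ :=
  ⨁ r : ℕ, GrPiece V σ r

/-- The image in `Λ` of the path of the quiver that starts at `σ` and follows the arrows with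
labels `i₁, i₂, …`. Every vertex is the source of exactly one arrow of each label, so the words in
three letters are exactly the paths starting at `σ`. Paths are composed from left to right. -/
noncomputable def pathElem {K : Type*} [Field K] {α β : K} {hβ : β ^ 2 = α} {V : VertexSystem hβ}
    (A : ArrowSystem V) : Equiv.Perm (Fin 4) → List (Fin 3) → DFK K 4 α (-α)
  | σ, [] => V.e σ
  | σ, i :: w => A.a σ i * pathElem A (nonSimple i * σ) w

theorem pathElem_mem {K : Type*} [Field K] {α β : K} {hβ : β ^ 2 = α} {V : VertexSystem hβ}
    (A : ArrowSystem V) (σ : Equiv.Perm (Fin 4)) (w : List (Fin 3)) :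
    pathElem A σ w ∈ radFil V σ w.length := by
  have hJ : ∀ (w : List (Fin 3)) (σ : Equiv.Perm (Fin 4)),
      pathElem A σ w ∈ Ring.jacobson (DFK K 4 α (-α)) ^ w.length := by
    intro w
    induction w with
    | nil =>
      intro σ
      rw [List.length_nil, Submodule.pow_zero, Ideal.one_eq_top]
      exact Submodule.mem_top
    | cons i w ih =>
      intro σ
      rw [List.length_cons, Ideal.IsTwoSided.pow_succ]
      exact Ideal.mul_mem_mul (A.mem_rad σ i) (ih _)
  refine ⟨pathElem A σ w, hJ w σ, ?_⟩
  cases w with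
  | nil => exact V.complete.idem σ
  | cons i w =>
    simp only [LinearMap.mulLeft_apply, pathElem]
    rw [← mul_assoc, A.left_e]

/-- The class in `gr Γ_σ`, in degree the length of the word, of the path from `σ` along a word. -/
noncomputable def pathClass {K : Type*} [Field K] {α β : K} {hβ : β ^ 2 = α}
    {V : VertexSystem hβ} (A : ArrowSystem V) (σ : Equiv.Perm (Fin 4)) (w : List (Fin 3)) :
    GrGamma V σ :=
  DirectSum.lof K ℕ (GrPiece V σ) w.length
    (Submodule.Quotient.mk ⟨pathElem A σ w, pathElem_mem A σ w⟩)

/-! ### The presented algebra and the nil-Coxeter algebra -/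

/-- The relations `sᵢ² = 0`, `s₁s₃ = s₃s₁`, `sᵢs₂sᵢ = s₂sᵢs₂` (`i = 1, 3`); indices are counted
from `0` here. -/
inductive GrRel (K : Type*) [Field K] : FreeAlgebra K (Fin 3) → FreeAlgebra K (Fin 3) → Prop
  | sq (i : Fin 3) : GrRel K (FreeAlgebra.ι K i * FreeAlgebra.ι K i) 0
  | comm : GrRel K (FreeAlgebra.ι K 0 * FreeAlgebra.ι K 2) (FreeAlgebra.ι K 2 * FreeAlgebra.ι K 0)
  | braid (i : Fin 3) (hi : i ≠ 1) :
      GrRel K (FreeAlgebra.ι K i * FreeAlgebra.ι K 1 * FreeAlgebra.ι K i)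
        (FreeAlgebra.ι K 1 * FreeAlgebra.ι K i * FreeAlgebra.ι K 1)

/-- The algebra `K⟨s₁, s₂, s₃⟩ / (sᵢ², s₁s₃ - s₃s₁, sᵢs₂sᵢ - s₂sᵢs₂)`. -/
abbrev PresentedAlgebra (K : Type*) [Field K] : Type _ := RingQuot (GrRel K)

/-- The generator `sᵢ` of the presented algebra. -/
noncomputable def presentedGen (K : Type*) [Field K] (i : Fin 3) : PresentedAlgebra K :=
  RingQuot.mkAlgHom K (GrRel K) (FreeAlgebra.ι K i)

/-- Relations of the nil-Coxeter algebra of a Coxeter group `W` with simple reflections `S i`: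
`uᵢ² = 0` and the braid relations `uᵢuⱼuᵢ⋯ = uⱼuᵢuⱼ⋯`, where both sides have as many factors as
the order of `S i * S j` (and there is no relation if that order is infinite, encoded by `0`). -/
inductive NilCoxeterRel (K : Type*) [Field K] {B W : Type*} [Group W] (S : B → W) :
    FreeAlgebra K B → FreeAlgebra K B → Prop
  | sq (i : B) : NilCoxeterRel K S (FreeAlgebra.ι K i * FreeAlgebra.ι K i) 0
  | braid (i j : B) :
      NilCoxeterRel K S
        ((CoxeterSystem.alternatingWord i j (orderOf (S i * S j))).map (FreeAlgebra.ι K)).prod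
        ((CoxeterSystem.alternatingWord j i (orderOf (S i * S j))).map (FreeAlgebra.ι K)).prod

/-- The nil-Coxeter algebra of a Coxeter group with simple reflections `S i`. -/
abbrev NilCoxeterAlgebra (K : Type*) [Field K] {B W : Type*} [Group W] (S : B → W) : Type _ :=
  RingQuot (NilCoxeterRel K S)

/-- The simple transpositions `(1 2)`, `(2 3)`, `(3 4)`, the Coxeter generators of `𝕊₄`. -/
def simpleTransposition (i : Fin 3) : Equiv.Perm (Fin 4) := Equiv.swap i.castSucc i.succ

/-! The algebra Λ is identified with an explicit algebra on 24 × 24 matrices. Let ℓ be the length on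
𝕊₄ for t₁, t₂, t₃, which are the adjacent transpositions of the letters arranged as 3, 1, 4, 2, and
put d(σ,τ) = ℓ(τσ⁻¹). In the geodesic algebra the matrix units satisfy E_{σρ}E_{ρτ} = E_{στ} if
d(σ,ρ) + d(ρ,τ) = d(σ,τ), and the product is 0 otherwise.

Write x_{ij} = β(2P_{ij} − 1). The relations of Λ say that P_{ji} = 1 − P_{ij}, that the P_{ij} are
idempotent, that they commute for disjoint pairs, and that P_{ij}P_{jk} + P_{jk}P_{ki} +
P_{ki}P_{ij} + 1 = P_{ij} + P_{jk} + P_{ki}. A table of integers gives such idempotents in the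
geodesic algebra, with diagonal entry 1 at σ if σ(i) < σ(j) and 0 otherwise; the identities are
finite checks. The resulting map is onto (`ofDFK_range`): products of the P_{ij} separate the
vertices, and commutators reach every unit step. Straightening words in Λ gives dim Λ ≤ 48·6·2 = 576
= 24² (`FKRelations.spannedBy`), so the map is an isomorphism.

Under it the powers of the radical become the filtration by distance (`mem_jacobson_pow_iff`), and
every admissible system of idempotents is conjugate to the E_{σσ} (`exists_conj`). With the
E_{σ,tᵢσ} as arrows, a path from σ is a matrix unit if its word is reduced, and 0 otherwise
(`map_pathElem`). So gr Γ_σ has a basis indexed by 𝕊₄ in which words have nil-Coxeter coordinates.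
The presented algebra is spanned by 24 elements and its words have the same coordinates
(`presentedCoeff_bijective`). Comparing coordinates gives the isomorphism, along which the product
is transported. -/

set_option linter.unusedSectionVars false

/-! ### Geodesic algebras -/

/-- A distance with values in `ℕ`, not necessarily symmetric, for which any two distinct points are
joined by a geodesic of unit steps. -/
class GeodesicSpace (X : Type*) where
  d : X → X → ℕ
  d_self : ∀ x, d x x = 0
  eq_of_d : ∀ x y, d x y = 0 → x = y
  triangle : ∀ x y z, d x z ≤ d x y + d y z
  step : ∀ x y n, d x y = n + 1 → ∃ z, d x z = 1 ∧ d z y = n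

/-- The geodesic algebra of `X`: matrices with the product `E x y * E y z = E x z` if `y` lies on a
geodesic from `x` to `z`, and `E x y * E y z = 0` otherwise. -/
def GeodesicAlgebra (K X : Type*) : Type _ := X → X → K

namespace GeodesicAlgebra

open GeodesicSpace

variable {K X : Type*} [Field K] [Fintype X] [DecidableEq X] [GeodesicSpace X]

instance : AddCommGroup (GeodesicAlgebra K X) := inferInstanceAs (AddCommGroup (X → X → K))
instance : Module K (GeodesicAlgebra K X) := inferInstanceAs (Module K (X → X → K))

instance : Mul (GeodesicAlgebra K X) :=
  ⟨fun f g x z => ∑ y, if d x y + d y z = d x z then f x y * g y z else 0⟩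

instance : One (GeodesicAlgebra K X) := ⟨fun x y => if x = y then 1 else 0⟩

@[ext] theorem ext {f g : GeodesicAlgebra K X} (h : ∀ x y, f x y = g x y) : f = g :=
  funext fun x => funext fun y => h x y

theorem mul_apply (f g : GeodesicAlgebra K X) (x z : X) :
    (f * g) x z = ∑ y, if d x y + d y z = d x z then f x y * g y z else 0 := rfl

theorem one_apply (x y : X) : (1 : GeodesicAlgebra K X) x y = if x = y then 1 else 0 := rfl

@[simp] theorem add_apply (f g : GeodesicAlgebra K X) (x y : X) : (f + g) x y = f x y + g x y := rfl

@[simp] theorem sub_apply (f g : GeodesicAlgebra K X) (x y : X) : (f - g) x y = f x y - g x y := rfl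

@[simp] theorem zero_apply (x y : X) : (0 : GeodesicAlgebra K X) x y = 0 := rfl

@[simp] theorem smul_apply (c : K) (f : GeodesicAlgebra K X) (x y : X) :
    (c • f) x y = c * f x y := rfl

@[simp] theorem sum_apply {ι : Type*} (s : Finset ι) (f : ι → GeodesicAlgebra K X) (x y : X) :
    (∑ i ∈ s, f i) x y = ∑ i ∈ s, f i x y := by
  induction s using Finset.cons_induction with
  | empty => rfl
  | cons a s ha ih => rw [Finset.sum_cons, Finset.sum_cons, add_apply, ih]

theorem ite_sum_univ (p : Prop) [Decidable p] (F : X → K) :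
    (if p then ∑ y, F y else 0) = ∑ y, if p then F y else 0 := by
  split_ifs <;> simp

instance : Ring (GeodesicAlgebra K X) :=
  { (inferInstance : AddCommGroup (GeodesicAlgebra K X)) with
    mul := (· * ·)
    one := 1
    left_distrib := fun f g h => by
      ext x y
      simp only [mul_apply, add_apply, ← Finset.sum_add_distrib]
      refine Finset.sum_congr rfl fun z _ => ?_
      split_ifs <;> ring
    right_distrib := fun f g h => by
      ext x y
      simp only [mul_apply, add_apply, ← Finset.sum_add_distrib]
      refine Finset.sum_congr rfl fun z _ => ?_
      split_ifs <;> ring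
    zero_mul := fun f => by ext x y; simp [mul_apply]
    mul_zero := fun f => by ext x y; simp [mul_apply]
    one_mul := fun f => by
      ext x y
      rw [mul_apply, Finset.sum_eq_single x]
      · simp [one_apply, d_self]
      · intro z _ hz
        simp [one_apply, hz.symm]
      · simp
    mul_one := fun f => by
      ext x y
      rw [mul_apply, Finset.sum_eq_single y]
      · simp [one_apply, d_self]
      · intro z _ hz
        simp [one_apply, hz]
      · simp
    mul_assoc := fun f g h => by
      ext x w
      simp only [mul_apply]
      -- Both bracketings become the sum over chains x, y, z, w with d x y + d y z + d z w = d x w.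
      -- By the triangle inequality this one condition is equivalent to either nested pair of
      -- conditions.
      have e1 : ∀ z, (if d x z + d z w = d x w then
          (∑ y, if d x y + d y z = d x z then f x y * g y z else 0) * h z w else 0)
          = ∑ y, if d x y + d y z + d z w = d x w then f x y * g y z * h z w else 0 := by
        intro z
        rw [Finset.sum_mul, ite_sum_univ]
        refine Finset.sum_congr rfl fun y _ => ?_
        have := triangle x y z
        have := triangle x z w
        split_ifs <;> first | rfl | omega | simp
      have e2 : ∀ y, (if d x y + d y w = d x w then
          f x y * (∑ z, if d y z + d z w = d y w then g y z * h z w else 0) else 0)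
          = ∑ z, if d x y + d y z + d z w = d x w then f x y * g y z * h z w else 0 := by
        intro y
        rw [Finset.mul_sum, ite_sum_univ]
        refine Finset.sum_congr rfl fun z _ => ?_
        have := triangle y z w
        have := triangle x y w
        split_ifs <;> first | omega | simp [mul_assoc]
      simp only [e1, e2]
      exact Finset.sum_comm
    zsmul := fun n f => n • f
    nsmul := fun n f => n • f }

theorem smul_mul (c : K) (f g : GeodesicAlgebra K X) : (c • f) * g = c • (f * g) := by
  ext x y
  simp only [mul_apply, smul_apply, Finset.mul_sum]
  refine Finset.sum_congr rfl fun z _ => ?_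
  split_ifs <;> ring

theorem mul_smul' (c : K) (f g : GeodesicAlgebra K X) : f * (c • g) = c • (f * g) := by
  ext x y
  simp only [mul_apply, smul_apply, Finset.mul_sum]
  refine Finset.sum_congr rfl fun z _ => ?_
  split_ifs <;> ring

instance : Algebra K (GeodesicAlgebra K X) := Algebra.ofModule smul_mul mul_smul'

/-- The matrix units of a geodesic algebra. -/
def unit (x y : X) : GeodesicAlgebra K X := fun x' y' => if x' = x ∧ y' = y then 1 else 0

theorem unit_apply (x y x' y' : X) :
    (unit x y : GeodesicAlgebra K X) x' y' = if x' = x ∧ y' = y then 1 else 0 := rfl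

theorem unit_mul_unit (x y z : X) :
    (unit x y * unit y z : GeodesicAlgebra K X) = if d x y + d y z = d x z then unit x z else 0 := by
  ext x' z'
  rw [mul_apply, Finset.sum_eq_single y]
  · by_cases h : x' = x ∧ z' = z
    · obtain ⟨rfl, rfl⟩ := h
      split_ifs <;> simp [unit_apply]
    · have : (unit x y x' y * unit y z y z' : K) = 0 := by
        simp only [unit_apply]; split_ifs <;> simp_all
      rw [this]
      split_ifs <;> simp [unit_apply, h]
  · intro w _ hw
    simp [unit_apply, hw]
  · simp

theorem unit_mul_unit_of_ne {x y y' z : X} (h : y ≠ y') :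
    (unit x y * unit y' z : GeodesicAlgebra K X) = 0 := by
  ext x' z'
  rw [mul_apply]
  refine Finset.sum_eq_zero fun w _ => ?_
  by_cases hw : w = y
  · subst hw; simp [unit_apply, h]
  · simp [unit_apply, hw]

theorem unit_mul_apply (x : X) (f : GeodesicAlgebra K X) (x' y : X) :
    (unit x x * f : GeodesicAlgebra K X) x' y = if x' = x then f x y else 0 := by
  rw [mul_apply, Finset.sum_eq_single x]
  · by_cases h : x' = x
    · subst h; simp [unit_apply, d_self]
    · simp [unit_apply, h]
  · intro w _ hw
    simp [unit_apply, hw]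
  · simp

theorem mul_unit_apply (y : X) (f : GeodesicAlgebra K X) (x y' : X) :
    (f * unit y y : GeodesicAlgebra K X) x y' = if y' = y then f x y else 0 := by
  rw [mul_apply, Finset.sum_eq_single y]
  · by_cases h : y' = y
    · subst h; simp [unit_apply, d_self]
    · simp [unit_apply, h]
  · intro w _ hw
    simp [unit_apply, hw]
  · simp

theorem sum_smul_unit (f : GeodesicAlgebra K X) : f = ∑ x, ∑ y, f x y • unit x y := by
  ext x y
  simp only [sum_apply, smul_apply, unit_apply]
  rw [Finset.sum_eq_single x, Finset.sum_eq_single y] <;> simp +contextual [eq_comm]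

theorem completeOrthogonalIdempotents_unit :
    CompleteOrthogonalIdempotents fun x : X => (unit x x : GeodesicAlgebra K X) where
  idem x := by simp [IsIdempotentElem, unit_mul_unit, d_self]
  ortho x y h := unit_mul_unit_of_ne h
  complete := by
    ext x y
    simp only [sum_apply, unit_apply, one_apply]
    by_cases h : x = y
    · subst h; simp
    · rw [if_neg h]
      refine Finset.sum_eq_zero fun z _ => if_neg ?_
      rintro ⟨rfl, rfl⟩
      exact h rfl

theorem finrank_eq : Module.finrank K (GeodesicAlgebra K X) = Fintype.card X * Fintype.card X := by
  change Module.finrank K (X → X → K) = _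
  simp [Module.finrank_pi_fintype]

instance : Module.Finite K (GeodesicAlgebra K X) := inferInstanceAs (Module.Finite K (X → X → K))

/-- The diagonal coefficients of the elements of a geodesic algebra are multiplicative. -/
def diag (x : X) : GeodesicAlgebra K X →ₐ[K] K :=
  AlgHom.ofLinearMap
    { toFun := fun f => f x x
      map_add' := fun _ _ => rfl
      map_smul' := fun _ _ => rfl }
    (by change (1 : GeodesicAlgebra K X) x x = 1; simp [one_apply])
    (by
      intro f g
      change (f * g) x x = f x x * g x x
      rw [mul_apply, Finset.sum_eq_single x]
      · simp [d_self]
      · intro y _ hy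
        have : d x y ≠ 0 := fun h => hy (eq_of_d _ _ h).symm
        rw [if_neg]
        rw [d_self]; omega
      · simp)

theorem diag_apply (x : X) (f : GeodesicAlgebra K X) : diag x f = f x x := rfl

/-- The elements whose coefficients vanish at distances less than `r`. -/
def fil (r : ℕ) : Submodule K (GeodesicAlgebra K X) where
  carrier := {f | ∀ x y, d x y < r → f x y = 0}
  add_mem' := fun hf hg x y h => by rw [add_apply, hf x y h, hg x y h, add_zero]
  zero_mem' := fun _ _ _ => rfl
  smul_mem' := fun c f hf x y h => by rw [smul_apply, hf x y h, mul_zero]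

theorem mem_fil {r : ℕ} {f : GeodesicAlgebra K X} :
    f ∈ fil (K := K) (X := X) r ↔ ∀ x y, d x y < r → f x y = 0 := Iff.rfl

theorem mem_fil_zero (f : GeodesicAlgebra K X) : f ∈ fil (K := K) (X := X) 0 := by simp [mem_fil]

theorem fil_anti {r s : ℕ} (h : r ≤ s) : fil (K := K) (X := X) s ≤ fil r :=
  fun _ hf x y hxy => hf x y (hxy.trans_le h)

theorem mul_mem_fil {r s : ℕ} {f g : GeodesicAlgebra K X} (hf : f ∈ fil (K := K) (X := X) r)
    (hg : g ∈ fil (K := K) (X := X) s) : f * g ∈ fil (K := K) (X := X) (r + s) := by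
  intro x z h
  rw [mul_apply]
  refine Finset.sum_eq_zero fun y _ => ?_
  split_ifs with hy
  · by_cases h1 : d x y < r
    · rw [hf x y h1, zero_mul]
    · rw [hg y z (by omega), mul_zero]
  · rfl

theorem unit_mem_fil (x y : X) : unit x y ∈ fil (K := K) (X := X) (d x y) := by
  intro x' y' h
  rw [unit_apply, if_neg]
  rintro ⟨rfl, rfl⟩
  exact lt_irrefl _ h

theorem exists_fil_eq_bot : ∃ n, fil (K := K) (X := X) n = ⊥ := by
  -- The sum of all distances, plus one, exceeds each single distance.
  refine ⟨∑ x : X, ∑ y : X, d x y + 1, (Submodule.eq_bot_iff _).2 fun f hf => ?_⟩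
  ext x y
  refine hf x y (Nat.lt_succ_of_le ?_)
  calc d x y ≤ ∑ y : X, d x y := Finset.single_le_sum (f := fun y => d x y) (by simp) (by simp)
    _ ≤ _ := Finset.single_le_sum (f := fun x => ∑ y : X, d x y) (by simp) (by simp)

theorem mem_fil_one {f : GeodesicAlgebra K X} :
    f ∈ fil (K := K) (X := X) 1 ↔ ∀ x, f x x = 0 := by
  constructor
  · intro h x
    exact h x x (by rw [d_self]; omega)
  · intro h x y hxy
    obtain rfl := eq_of_d x y (by omega)
    exact h x

/-- A subalgebra of a geodesic algebra that contains approximations of the diagonal matrix units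
and elements of the radical with nonzero coefficients at all unit steps is everything. -/
theorem subalgebra_eq_top (S : Subalgebra K (GeodesicAlgebra K X))
    (h0 : ∀ x : X, ∃ s ∈ S, s - unit x x ∈ fil (K := K) (X := X) 1)
    (h1 : ∀ x y : X, d x y = 1 → ∃ s ∈ S, s ∈ fil (K := K) (X := X) 1 ∧ s x y ≠ 0) : S = ⊤ := by
  -- Each matrix unit lies in `S` up to terms of larger distance: distances 0 and 1 come from the
  -- hypotheses, larger ones from splitting off the first step of a geodesic.
  have approx : ∀ n (x y : X), d x y = n →
      ∃ s ∈ S, s - unit x y ∈ fil (K := K) (X := X) (n + 1) := by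
    intro n
    induction n using Nat.strong_induction_on with
    | _ n ih =>
      intro x y h
      rcases n with _ | _ | n
      · obtain rfl := eq_of_d _ _ h
        exact h0 x
      · obtain ⟨s, hs, hs1, hsx⟩ := h1 x y h
        obtain ⟨p, hp, hp1⟩ := h0 x
        obtain ⟨q, hq, hq1⟩ := h0 y
        refine ⟨(s x y)⁻¹ • (p * s * q), S.smul_mem (S.mul_mem (S.mul_mem hp hs) hq) _, ?_⟩
        have e : (s x y)⁻¹ • (p * s * q) - unit x y
            = (s x y)⁻¹ • ((p - unit x x) * s * q + unit x x * s * (q - unit y y))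
              + ((s x y)⁻¹ • (unit x x * s * unit y y) - unit x y) := by
          rw [add_sub, ← smul_add]
          congr 2
          noncomm_ring
        have e' : (s x y)⁻¹ • (unit x x * s * unit y y) = unit x y := by
          ext x' y'
          rw [smul_apply, mul_unit_apply, unit_mul_apply, unit_apply]
          by_cases h1 : x' = x <;> by_cases h2 : y' = y <;> simp [h1, h2, hsx]
        rw [e, e', sub_self, add_zero]
        refine Submodule.smul_mem _ _ (Submodule.add_mem _ ?_ ?_)
        · exact fil_anti (by omega) (mul_mem_fil (mul_mem_fil hp1 hs1) (mem_fil_zero q))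
        · exact mul_mem_fil (mul_mem_fil (mem_fil_zero (unit x x)) hs1) hq1
      · obtain ⟨z, hz1, hz2⟩ := step x y (n + 1) h
        obtain ⟨s, hs, hs1⟩ := ih 1 (by omega) x z hz1
        obtain ⟨t, ht, ht1⟩ := ih (n + 1) (by omega) z y hz2
        refine ⟨s * t, S.mul_mem hs ht, ?_⟩
        have e : s * t - unit x y = (s - unit x z) * (t - unit z y)
            + (s - unit x z) * unit z y + unit x z * (t - unit z y)
            + (unit x z * unit z y - unit x y) := by noncomm_ring
        rw [e, unit_mul_unit, if_pos (by omega), sub_self, add_zero]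
        refine Submodule.add_mem _ (Submodule.add_mem _ ?_ ?_) ?_
        · exact fil_anti (by omega) (mul_mem_fil hs1 ht1)
        · exact fil_anti (by omega) (mul_mem_fil hs1 (unit_mem_fil z y))
        · exact fil_anti (by omega) (mul_mem_fil (unit_mem_fil x z) ht1)
  obtain ⟨N, hN⟩ := exists_fil_eq_bot (K := K) (X := X)
  -- Descending induction along the filtration, which ends in 0: the error terms of `approx` lie one
  -- layer deeper.
  have key : ∀ k ≤ N, ∀ f ∈ fil (K := K) (X := X) (N - k), f ∈ S := by
    intro k
    induction k with
    | zero =>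
      intro _ f hf
      rw [Nat.sub_zero, hN, Submodule.mem_bot] at hf
      exact hf ▸ S.zero_mem
    | succ k ih =>
      intro hk f hf
      rw [sum_smul_unit f]
      refine S.sum_mem fun x _ => S.sum_mem fun y _ => ?_
      by_cases hxy : d x y < N - (k + 1)
      · rw [hf x y hxy, zero_smul]
        exact S.zero_mem
      · obtain ⟨s, hs, hs1⟩ := approx _ x y rfl
        have : unit x y = s - (s - unit x y) := by abel
        rw [this]
        exact S.smul_mem (S.sub_mem hs (ih (by omega) _ (fil_anti (by omega) hs1))) _
  refine Algebra.eq_top_iff.2 fun f => key N le_rfl f ?_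
  rw [Nat.sub_self]
  exact mem_fil_zero f

theorem isNilpotent_of_mem_fil_one {f : GeodesicAlgebra K X} (hf : f ∈ fil (K := K) (X := X) 1) :
    IsNilpotent f := by
  obtain ⟨n, hn⟩ := exists_fil_eq_bot (K := K) (X := X)
  have h : ∀ n, f ^ n ∈ fil (K := K) (X := X) n := by
    intro n
    induction n with
    | zero => exact mem_fil_zero _
    | succ n ih => rw [pow_succ]; exact mul_mem_fil ih hf
  refine ⟨n, ?_⟩
  have := h n
  rwa [hn, Submodule.mem_bot] at this

/-- Complete systems of orthogonal idempotents with the right diagonals are conjugate to the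
diagonal matrix units. -/
theorem exists_conj {f : X → GeodesicAlgebra K X} (hf : CompleteOrthogonalIdempotents f)
    (hd : ∀ x y, f y x x = if x = y then 1 else 0) :
    ∃ u : (GeodesicAlgebra K X)ˣ, ∀ x, f x * (u : GeodesicAlgebra K X) = (u : GeodesicAlgebra K X) * unit x x := by
  have hE := completeOrthogonalIdempotents_unit (K := K) (X := X)
  -- The standard intertwiner of two complete systems of orthogonal idempotents. Its diagonal
  -- entries are 1, so it is unipotent and hence invertible.
  set u : GeodesicAlgebra K X := ∑ x, f x * unit x x with hu
  have h1 : ∀ x, f x * u = f x * unit x x := by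
    intro x
    rw [hu, Finset.mul_sum, Finset.sum_eq_single x]
    · rw [← mul_assoc, (hf.idem x).eq]
    · intro y _ hy
      rw [← mul_assoc, hf.ortho hy.symm, zero_mul]
    · simp
  have h2 : ∀ x, u * unit x x = f x * unit x x := by
    intro x
    rw [hu, Finset.sum_mul, Finset.sum_eq_single x]
    · rw [mul_assoc, (hE.idem x).eq]
    · intro y _ hy
      rw [mul_assoc, hE.ortho hy, mul_zero]
    · simp
  have hdu : 1 - u ∈ fil (K := K) (X := X) 1 := by
    rw [mem_fil_one]
    intro x
    change diag x (1 - u) = 0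
    rw [map_sub, map_one, hu, map_sum, Finset.sum_eq_single x]
    · rw [map_mul, diag_apply, diag_apply, hd, unit_apply]
      simp
    · intro y _ hy
      rw [map_mul, diag_apply, diag_apply, hd, if_neg hy.symm, zero_mul]
    · simp
  have hun : IsUnit u := by
    simpa using (isNilpotent_of_mem_fil_one hdu).isUnit_one_sub
  obtain ⟨v, hv⟩ := hun
  exact ⟨v, fun x => by rw [hv, h1, h2]⟩

/-! ### The radical filtration of an algebra isomorphic to a geodesic algebra -/

section Radical

variable {R : Type*} [Ring R] [Algebra K R] (φ : R ≃ₐ[K] GeodesicAlgebra K X)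

/-- The elements with zero diagonal form a nil ideal, and the diagonal entries are characters to the
field `K`, so the radical lies in their kernels. -/
theorem mem_jacobson_iff (r : R) : r ∈ Ring.jacobson R ↔ φ r ∈ fil (K := K) (X := X) 1 := by
  rw [← Ideal.jacobson_bot, Ideal.mem_jacobson_iff, mem_fil_one]
  constructor
  · intro h x
    by_contra hx
    -- This multiplier makes the character at `x` vanish on 1 + y r, which therefore has no left
    -- inverse.
    obtain ⟨z, hz⟩ := h (algebraMap K R (-(φ r x x)⁻¹))
    rw [Ideal.mem_bot] at hz
    have := congrArg (fun t => diag x (φ t)) hz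
    simp only [map_sub, map_add, map_mul, map_one, map_zero, AlgEquiv.commutes,
      AlgHom.commutes, Algebra.algebraMap_self, RingHom.id_apply] at this
    rw [diag_apply x (φ r), mul_assoc, neg_mul, inv_mul_cancel₀ hx] at this
    simp at this
  · intro h y
    have hn : φ (y * r) ∈ fil (K := K) (X := X) 1 := by
      rw [map_mul, mem_fil_one]
      intro x
      change diag x (φ y * φ r) = 0
      rw [map_mul, diag_apply x (φ r), h x, mul_zero]
    have hnil : IsNilpotent (y * r) := by
      obtain ⟨n, hn⟩ := isNilpotent_of_mem_fil_one hn
      exact ⟨n, φ.injective (by rw [map_pow, hn, map_zero])⟩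
    obtain ⟨u, hu⟩ := hnil.isUnit_one_add
    refine ⟨↑u⁻¹, ?_⟩
    have : (↑u⁻¹ : R) * (1 + y * r) = 1 := by rw [← hu, Units.inv_mul]
    rw [Ideal.mem_bot, ← this]
    noncomm_ring

/-- Distances add in nonzero products, which gives one inclusion. Conversely, a matrix unit at
distance at least n factors along a geodesic, each unit step contributing a factor in the radical.
-/
theorem mem_jacobson_pow_iff (n : ℕ) (r : R) :
    r ∈ Ring.jacobson R ^ n ↔ φ r ∈ fil (K := K) (X := X) n := by
  constructor
  · intro h
    induction n generalizing r with
    | zero => exact mem_fil_zero _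
    | succ n ih =>
      rw [Ideal.IsTwoSided.pow_succ] at h
      refine Submodule.mul_induction_on h (fun a ha b hb => ?_) (fun a b ha hb => ?_)
      · rw [map_mul, add_comm]
        exact mul_mem_fil ((mem_jacobson_iff φ a).1 ha) (ih b hb)
      · rw [map_add]
        exact Submodule.add_mem _ ha hb
  · intro h
    have hu : ∀ n (x y : X), n ≤ d x y → φ.symm (unit x y) ∈ Ring.jacobson R ^ n := by
      intro n
      induction n with
      | zero =>
        intro x y _
        rw [Submodule.pow_zero, Ideal.one_eq_top]
        trivial
      | succ n ih =>
        intro x y hxy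
        obtain ⟨m, hm⟩ : ∃ m, d x y = m + 1 := ⟨d x y - 1, by omega⟩
        obtain ⟨z, hz1, hz2⟩ := step x y m hm
        have e : (unit x y : GeodesicAlgebra K X) = unit x z * unit z y := by
          rw [unit_mul_unit, if_pos (by omega)]
        rw [e, map_mul, Ideal.IsTwoSided.pow_succ]
        refine Ideal.mul_mem_mul ((mem_jacobson_iff φ _).2 ?_) (ih z y (by omega))
        rw [AlgEquiv.apply_symm_apply, ← hz1]
        exact unit_mem_fil x z
    rw [← φ.symm_apply_apply r, sum_smul_unit (φ r), map_sum]
    refine Ideal.sum_mem _ fun x _ => ?_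
    rw [map_sum]
    refine Ideal.sum_mem _ fun y _ => ?_
    rw [map_smul, Algebra.smul_def]
    by_cases hxy : d x y < n
    · rw [h x y hxy, map_zero, zero_mul]
      exact Ideal.zero_mem _
    · exact Ideal.mul_mem_left _ _ (hu n x y (by omega))

/-- The corner cut out by E_{xx} is K·E_{xx}, where 0 and 1 are the only idempotents. -/
theorem isPrimitiveIdempotent_of_map_eq_unit {e : R} {x : X} (he : φ e = unit x x) :
    IsPrimitiveIdempotent e := by
  refine ⟨?_, ?_, ?_⟩
  · apply φ.injective
    rw [map_mul, he, unit_mul_unit, if_pos (by simp [d_self])]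
  · rintro rfl
    have := congrFun (congrFun he x) x
    rw [map_zero, unit_apply] at this
    simp at this
  · intro f g hf hg hfg hgf hefg
    have hef : e * f = f := by rw [hefg, add_mul, hf.eq, hgf, add_zero]
    have hfe : f * e = f := by rw [hefg, mul_add, hf.eq, hfg, add_zero]
    have h1 : unit x x * φ f = φ f := by rw [← he, ← map_mul, hef]
    have h2 : φ f * unit x x = φ f := by rw [← he, ← map_mul, hfe]
    have hfx : φ f = φ f x x • unit x x := by
      ext a b
      rw [← h2, ← h1, mul_unit_apply, unit_mul_apply, h1, h2, smul_apply, unit_apply]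
      by_cases ha : a = x <;> by_cases hb : b = x <;> simp [ha, hb]
    have hc : φ f x x * φ f x x = φ f x x := by
      change diag x (φ f) * diag x (φ f) = diag x (φ f)
      rw [← map_mul, ← map_mul, hf.eq]
    rcases (IsIdempotentElem.iff_eq_zero_or_one (p := φ f x x)).1 hc with h | h
    · left
      rw [h, zero_smul] at hfx
      exact φ.injective (by rw [hfx, map_zero])
    · right
      rw [h, one_smul, ← he] at hfx
      have := φ.injective hfx
      rw [hefg] at this
      simpa using this

end Radical

end GeodesicAlgebra

/-! ### The symmetric group on four letters as a geodesic space -/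

/-- One-line notation of a permutation of four letters, read as a decimal number. -/
def oneLine (w : Equiv.Perm (Fin 4)) : ℕ := 1000 * w 0 + 100 * w 1 + 10 * w 2 + w 3

/-- The length of a permutation with respect to the Coxeter generators `(1 3)`, `(1 4)`, `(2 4)`:
the number of inversions with respect to the order `3, 1, 4, 2` of the letters. -/
def skewLength (w : Equiv.Perm (Fin 4)) : ℕ :=
  let pos : Fin 4 → ℕ := ![1, 3, 0, 2]
  ([(2, 0), (2, 3), (2, 1), (0, 3), (0, 1), (3, 1)] : List (Fin 4 × Fin 4)).countP
    fun p => pos (w p.2) < pos (w p.1)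

theorem skewLength_mul_le :
    ∀ u v : Equiv.Perm (Fin 4), skewLength (u * v) ≤ skewLength u + skewLength v := by
  decide +kernel

theorem eq_one_of_skewLength : ∀ w : Equiv.Perm (Fin 4), skewLength w = 0 → w = 1 := by
  decide +kernel

/-- Existence of a right descent; it yields both geodesics and reduced words. -/
theorem exists_skewLength_mul_nonSimple : ∀ w : Equiv.Perm (Fin 4), skewLength w ≠ 0 →
    ∃ i, skewLength (w * nonSimple i) + 1 = skewLength w := by
  decide +kernel

theorem eq_nonSimple_of_skewLength : ∀ w : Equiv.Perm (Fin 4), skewLength w = 1 →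
    ∃ i, w = nonSimple i := by
  decide +kernel

theorem skewLength_nonSimple : ∀ i, skewLength (nonSimple i) = 1 := by decide +kernel

theorem nonSimple_inv : ∀ i, (nonSimple i)⁻¹ = nonSimple i := by decide +kernel

/-- The path metric of the graph with edges σ — tᵢσ. It is invariant under right multiplication, so
checks depend only on τσ⁻¹. A right descent of τσ⁻¹ is the first step of a geodesic from σ. -/
instance : GeodesicSpace (Equiv.Perm (Fin 4)) where
  d σ τ := skewLength (τ * σ⁻¹)
  d_self σ := by rw [mul_inv_cancel]; decide
  eq_of_d σ τ h := (mul_inv_eq_one.1 (eq_one_of_skewLength _ h)).symm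
  triangle σ τ ρ := by
    have := skewLength_mul_le (ρ * τ⁻¹) (τ * σ⁻¹)
    rw [mul_assoc, inv_mul_cancel_left] at this
    omega
  step σ τ n h := by
    obtain ⟨i, hi⟩ := exists_skewLength_mul_nonSimple (τ * σ⁻¹) (by omega)
    refine ⟨nonSimple i * σ, ?_, ?_⟩
    · rw [mul_inv_cancel_right, skewLength_nonSimple]
    · rw [mul_inv_rev, nonSimple_inv, ← mul_assoc]
      omega

theorem d_perm (σ τ : Equiv.Perm (Fin 4)) : GeodesicSpace.d σ τ = skewLength (τ * σ⁻¹) := rfl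

/-! ### Integer tables and finite checks -/

/-- The nontrivial coefficients of the idempotents `orderIdem`, as functions of the one-line notation
of a permutation. -/
def orderTable : ℕ → List (ℕ × ℤ)
  | 02 => [(2103, 1), (3102, 1), (3201, -1), (1032, -1), (3012, -1)]
  | 03 => [(3120, -1), (2130, -1), (3021, -1), (2031, -1), (2310, -1), (3201, -1), (1032, 1)]
  | 12 => [(1302, -1), (1032, 1)]
  | 13 => [(0321, 1), (1320, 1), (2310, -1), (1032, -1), (1230, -1)]
  -- The pairs (0,1) and (2,3) have no off-diagonal coefficients.
  | _ => []

/-- The coefficients of the idempotents `orderIdem` for letters in increasing order. -/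
def upperCoeff (i j : Fin 4) (w : Equiv.Perm (Fin 4)) : ℤ :=
  if oneLine w = 0123 then 1 else ((orderTable (10 * i + j)).lookup (oneLine w)).getD 0

/-- The coefficients of the idempotents `orderIdem`. -/
def orderCoeff (i j : Fin 4) (w : Equiv.Perm (Fin 4)) : ℤ :=
  if i < j then upperCoeff i j w else (if oneLine w = 0123 then 1 else 0) - upperCoeff j i w

/-- The coefficients of products of two of the idempotents `orderIdem`. -/
def orderMul (i j k l : Fin 4) (w : Equiv.Perm (Fin 4)) : ℤ :=
  -- The outer test does not change the value; it only skips zero terms in the evaluation. The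
  -- second factor is read in the row of u, which moves the letters k, l to u k, u l.
  ∑ u : Equiv.Perm (Fin 4), if orderCoeff i j u = 0 then 0 else
    if skewLength u + skewLength (w * u⁻¹) = skewLength w then
      orderCoeff i j u * orderCoeff (u k) (u l) (w * u⁻¹) else 0

theorem orderCoeff_one : ∀ i j : Fin 4, i ≠ j → orderCoeff i j 1 = if i < j then 1 else 0 := by
  decide +kernel

theorem orderCoeff_swap : ∀ i j : Fin 4, i ≠ j → ∀ w,
    orderCoeff j i w = (if w = 1 then 1 else 0) - orderCoeff i j w := by
  decide +kernel

theorem orderMul_self : ∀ i j : Fin 4, i ≠ j → ∀ w, orderMul i j i j w = orderCoeff i j w := by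
  decide +kernel

theorem orderMul_comm : ∀ i j k l : Fin 4,
    i ≠ j ∧ k ≠ l ∧ i ≠ k ∧ i ≠ l ∧ j ≠ k ∧ j ≠ l → ∀ w, orderMul i j k l w = orderMul k l i j w := by
  decide +kernel

theorem orderMul_triangle : ∀ i j k : Fin 4, i ≠ j ∧ j ≠ k ∧ k ≠ i → ∀ w,
    orderMul i j j k w + orderMul j k k i w + orderMul k i i j w + (if w = 1 then 1 else 0) =
      orderCoeff i j w + orderCoeff j k w + orderCoeff k i w := by
  decide +kernel

/-- Commutators have zero diagonal, so they lie in the radical; here they are seen to reach each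
generator t_c. -/
theorem exists_orderMul_sub_ne_zero : ∀ c, ∃ i j k l : Fin 4, i ≠ j ∧ k ≠ l ∧
    orderMul i j k l (nonSimple c) - orderMul k l i j (nonSimple c) ≠ 0 := by
  decide +kernel

theorem exists_order_ne : ∀ σ τ : Equiv.Perm (Fin 4), σ ≠ τ → ∃ i j, σ i < σ j ∧ τ j < τ i := by
  decide +kernel

/-! ### The homomorphism from Λ onto the geodesic algebra -/

namespace GeodesicAlgebra

variable (K : Type*) [Field K]

/-- The geodesic algebra of the symmetric group on four letters. -/
abbrev PermAlgebra : Type _ := GeodesicAlgebra K (Equiv.Perm (Fin 4))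

/-- The idempotents that correspond to `(1 + β⁻¹ x_{ij}) / 2`. -/
def orderIdem (i j : Fin 4) : PermAlgebra K := fun σ τ => (orderCoeff (σ i) (σ j) (τ * σ⁻¹) : K)

variable {K}

theorem orderIdem_apply (i j : Fin 4) (σ τ : Equiv.Perm (Fin 4)) :
    orderIdem K i j σ τ = (orderCoeff (σ i) (σ j) (τ * σ⁻¹) : K) := rfl

theorem orderIdem_mul_apply (i j k l : Fin 4) (σ τ : Equiv.Perm (Fin 4)) :
    (orderIdem K i j * orderIdem K k l : PermAlgebra K) σ τ
      = (orderMul (σ i) (σ j) (σ k) (σ l) (τ * σ⁻¹) : K) := by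
  rw [mul_apply, orderMul, Int.cast_sum]
  -- Right invariance: with u = ρσ⁻¹, row σ becomes the row of the identity with each letter i
  -- relabelled σ i.
  refine Fintype.sum_equiv (Equiv.mulRight σ⁻¹) _ _ fun ρ => ?_
  have e1 : τ * σ⁻¹ * (ρ * σ⁻¹)⁻¹ = τ * ρ⁻¹ := by group
  have e2 : ∀ x, (ρ * σ⁻¹) (σ x) = ρ x := fun x => by simp
  simp only [Equiv.coe_mulRight, e1, e2, d_perm, orderIdem_apply]
  by_cases h0 : orderCoeff (σ i) (σ j) (ρ * σ⁻¹) = 0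
  · simp [h0]
  · rw [if_neg h0]
    split_ifs <;> simp

theorem one_perm_apply (σ τ : Equiv.Perm (Fin 4)) :
    (1 : PermAlgebra K) σ τ = (((if τ * σ⁻¹ = 1 then 1 else 0 : ℤ)) : K) := by
  rw [one_apply]
  simp only [mul_inv_eq_one, eq_comm (a := τ)]
  split_ifs <;> simp

theorem orderIdem_swap {i j : Fin 4} (h : i ≠ j) : orderIdem K j i = 1 - orderIdem K i j := by
  ext σ τ
  rw [sub_apply, one_perm_apply, orderIdem_apply, orderIdem_apply,
    orderCoeff_swap _ _ (σ.injective.ne h), Int.cast_sub]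

theorem orderIdem_mul_self {i j : Fin 4} (h : i ≠ j) :
    orderIdem K i j * orderIdem K i j = orderIdem K i j := by
  ext σ τ
  rw [orderIdem_mul_apply, orderMul_self _ _ (σ.injective.ne h), orderIdem_apply]

theorem orderIdem_comm {i j k l : Fin 4} (hij : i ≠ j) (hkl : k ≠ l) (hik : i ≠ k) (hil : i ≠ l)
    (hjk : j ≠ k) (hjl : j ≠ l) :
    orderIdem K i j * orderIdem K k l = orderIdem K k l * orderIdem K i j := by
  ext σ τ
  have h := fun {a b : Fin 4} (h : a ≠ b) => σ.injective.ne h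
  rw [orderIdem_mul_apply, orderIdem_mul_apply,
    orderMul_comm _ _ _ _ ⟨h hij, h hkl, h hik, h hil, h hjk, h hjl⟩]

theorem orderIdem_triangle {i j k : Fin 4} (hij : i ≠ j) (hjk : j ≠ k) (hki : k ≠ i) :
    orderIdem K i j * orderIdem K j k + orderIdem K j k * orderIdem K k i
      + orderIdem K k i * orderIdem K i j + 1
      = orderIdem K i j + orderIdem K j k + orderIdem K k i := by
  ext σ τ
  have h := fun {a b : Fin 4} (h : a ≠ b) => σ.injective.ne h
  simp only [add_apply, orderIdem_mul_apply, one_perm_apply, orderIdem_apply]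
  exact_mod_cast congrArg (Int.cast : ℤ → K) (orderMul_triangle _ _ _ ⟨h hij, h hjk, h hki⟩ _)

theorem orderIdem_diag {i j : Fin 4} (h : i ≠ j) (σ : Equiv.Perm (Fin 4)) :
    orderIdem K i j σ σ = if σ i < σ j then 1 else 0 := by
  rw [orderIdem_apply, mul_inv_cancel, orderCoeff_one _ _ (σ.injective.ne h)]
  split_ifs <;> simp

variable {α β : K}

/-- The images of the generators of the deformed Fomin-Kirillov algebra. -/
def genImage (β : K) (p : OffDiag 4) : PermAlgebra K := β • (2 • orderIdem K p.1.1 p.1.2 - 1)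

/-- Substituting x = β(2P − 1) turns each quadratic relation into β² times 4 times the identity for
the idempotents P. -/
theorem genImage_rel (hβ : β ^ 2 = α) ⦃x y : FreeAlgebra K (OffDiag 4)⦄
    (h : DFKRel K 4 α (-α) x y) :
    FreeAlgebra.lift K (genImage β) x = FreeAlgebra.lift K (genImage β) y := by
  subst hβ
  have hsm : ∀ a b : PermAlgebra K, β • a * β • b = (β ^ 2) • (a * b) := fun a b => by
    rw [smul_mul_smul_comm, sq]
  cases h with
  | antisymm i j h =>
    simp only [freeX, FreeAlgebra.lift_ι_apply, map_neg, genImage, orderIdem_swap h, ← smul_neg]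
    congr 1
    noncomm_ring
  | sq i j h =>
    rw [AlgHom.commutes, Algebra.algebraMap_eq_smul_one]
    simp only [freeX, map_mul, FreeAlgebra.lift_ι_apply, genImage, hsm]
    congr 1
    linear_combination (norm := noncomm_ring) 4 * orderIdem_mul_self (K := K) h
  | comm i j k l hij hkl hik hil hjk hjl =>
    simp only [freeX, map_mul, FreeAlgebra.lift_ι_apply, genImage, hsm]
    congr 1
    linear_combination (norm := noncomm_ring) 4 * orderIdem_comm (K := K) hij hkl hik hil hjk hjl
  | triangle i j k hij hjk hki =>
    rw [AlgHom.commutes, Algebra.algebraMap_eq_smul_one]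
    simp only [freeX, map_mul, map_add, FreeAlgebra.lift_ι_apply, genImage, hsm,
      neg_smul, ← smul_neg, ← smul_add]
    congr 1
    linear_combination (norm := noncomm_ring) 4 * orderIdem_triangle (K := K) hij hjk hki

/-- The homomorphism from the deformed Fomin-Kirillov algebra to the geodesic algebra. -/
noncomputable def ofDFK (hβ : β ^ 2 = α) : DFK K 4 α (-α) →ₐ[K] PermAlgebra K :=
  RingQuot.liftAlgHom K ⟨FreeAlgebra.lift K (genImage β), genImage_rel hβ⟩

end GeodesicAlgebra

namespace DFK

/-- The generator `x_{ij}` of the deformed Fomin-Kirillov algebra. -/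
noncomputable def gen {K : Type*} [Field K] {n : ℕ} (α₁ α₂ : K) (p : OffDiag n) : DFK K n α₁ α₂ :=
  RingQuot.mkAlgHom K _ (FreeAlgebra.ι K p)

end DFK

namespace GeodesicAlgebra

variable {K : Type*} [Field K] {α β : K}

theorem ofDFK_gen (hβ : β ^ 2 = α) (p : OffDiag 4) :
    ofDFK hβ (DFK.gen α (-α) p) = genImage β p := by
  rw [ofDFK, DFK.gen]
  erw [RingQuot.liftAlgHom_mkAlgHom_apply]
  rw [FreeAlgebra.lift_ι_apply]

theorem rho_gen (hβ : β ^ 2 = α) (σ : Equiv.Perm (Fin 4)) (p : OffDiag 4) :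
    rho hβ σ (DFK.gen α (-α) p) = rhoGen β σ p := by
  rw [rho, DFK.gen]
  erw [RingQuot.liftAlgHom_mkAlgHom_apply]
  rw [FreeAlgebra.lift_ι_apply]

theorem DFK_algHom_ext {n : ℕ} {α₁ α₂ : K} {A : Type*} [Ring A] [Algebra K A]
    {f g : DFK K n α₁ α₂ →ₐ[K] A} (h : ∀ p, f (DFK.gen α₁ α₂ p) = g (DFK.gen α₁ α₂ p)) :
    f = g := by
  refine RingQuot.ringQuot_ext' K f g ?_
  exact FreeAlgebra.hom_ext (funext h)

theorem diag_comp_ofDFK (hβ : β ^ 2 = α) (σ : Equiv.Perm (Fin 4)) :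
    (diag σ).comp (ofDFK hβ) = rho hβ σ := by
  refine DFK_algHom_ext fun p => ?_
  rw [AlgHom.comp_apply, ofDFK_gen, rho_gen, genImage, rhoGen, map_smul, map_sub, map_one,
    map_nsmul, diag_apply, orderIdem_diag p.2]
  split_ifs
  · simp; ring
  · simp

theorem orderIdem_mem_range [CharZero K] (hα : α ≠ 0) (hβ : β ^ 2 = α) {i j : Fin 4} (h : i ≠ j) :
    orderIdem K i j ∈ (ofDFK hβ).range := by
  have hβ0 : β ≠ 0 := by rintro rfl; exact hα (by rw [← hβ]; simp)
  refine ⟨(2 : K)⁻¹ • (β⁻¹ • DFK.gen α (-α) ⟨(i, j), h⟩ + 1), ?_⟩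
  change ofDFK hβ _ = _
  rw [map_smul, map_add, map_smul, ofDFK_gen, genImage, map_one, smul_smul, inv_mul_cancel₀ hβ0,
    one_smul, sub_add_cancel, ← Nat.cast_smul_eq_nsmul K, smul_smul]
  norm_num

/-- The criterion `subalgebra_eq_top` applies. Characteristic 0 allows division by 2 and keeps the
integer coefficients at unit steps nonzero. -/
theorem ofDFK_range [CharZero K] (hα : α ≠ 0) (hβ : β ^ 2 = α) : (ofDFK hβ).range = ⊤ := by
  refine subalgebra_eq_top _ (fun σ => ?_) (fun σ τ hστ => ?_)
  -- The product of the P_{ij} over all pairs that σ puts in order has diagonal 1 at σ. At any other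
  -- τ some pair is reversed, and the diagonal entry is 0.
  · set l := (Finset.univ.filter fun p : Fin 4 × Fin 4 => σ p.1 < σ p.2).toList with hl
    have hmem : ∀ p, p ∈ l ↔ σ p.1 < σ p.2 := fun p => by simp [hl]
    have hne : ∀ p : Fin 4 × Fin 4, σ p.1 < σ p.2 → p.1 ≠ p.2 := fun p h h' => by
      rw [h'] at h; exact lt_irrefl _ h
    refine ⟨(l.map fun p => orderIdem K p.1 p.2).prod, ?_, mem_fil_one.2 fun τ => ?_⟩
    · refine Subalgebra.list_prod_mem _ fun x hx => ?_
      obtain ⟨p, hp, rfl⟩ := List.mem_map.1 hx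
      exact orderIdem_mem_range hα hβ (hne p ((hmem p).1 hp))
    · rw [sub_apply, sub_eq_zero, unit_apply]
      refine (map_list_prod (diag (K := K) τ) _).trans ?_
      rw [List.map_map]
      by_cases h : τ = σ
      · subst h
        rw [if_pos ⟨rfl, rfl⟩]
        refine List.prod_eq_one fun x hx => ?_
        obtain ⟨p, hp, rfl⟩ := List.mem_map.1 hx
        rw [Function.comp_apply, diag_apply, orderIdem_diag (hne p ((hmem p).1 hp)),
          if_pos ((hmem p).1 hp)]
      · rw [if_neg fun h' => h h'.1]
        obtain ⟨i, j, hij, hji⟩ := exists_order_ne σ τ (Ne.symm h)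
        refine List.prod_eq_zero (List.mem_map.2 ⟨(i, j), (hmem _).2 hij, ?_⟩)
        rw [Function.comp_apply, diag_apply, orderIdem_diag (hne (i, j) hij),
          if_neg (not_lt_of_gt hji)]
  · obtain ⟨c, hc⟩ := eq_nonSimple_of_skewLength _ hστ
    obtain ⟨i, j, k, l, hij, hkl, h⟩ := exists_orderMul_sub_ne_zero c
    -- The letters are pulled back along σ, so that row σ of the commutator is the tabulated one.
    have hij' : σ.symm i ≠ σ.symm j := σ.symm.injective.ne hij
    have hkl' : σ.symm k ≠ σ.symm l := σ.symm.injective.ne hkl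
    have h1 := orderIdem_mem_range hα hβ hij'
    have h2 := orderIdem_mem_range hα hβ hkl'
    refine ⟨_, Subalgebra.sub_mem _ (Subalgebra.mul_mem _ h1 h2) (Subalgebra.mul_mem _ h2 h1),
      mem_fil_one.2 fun ρ => ?_, ?_⟩
    · refine (map_sub (diag (K := K) ρ) _ _).trans ?_
      rw [ map_mul, map_mul, mul_comm, sub_self]
    · rw [sub_apply, orderIdem_mul_apply, orderIdem_mul_apply, hc]
      simp only [Equiv.apply_symm_apply]
      exact_mod_cast h

end GeodesicAlgebra

/-! ### An upper bound for the dimension -/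

section Span

variable {K R : Type*} [Field K] [Ring R] [Algebra K R]

/-- The submodule `M` is contained in the span of `n` elements. -/
def SpannedBy (M : Submodule K R) (n : ℕ) : Prop :=
  ∃ f : Fin n → R, M ≤ Submodule.span K (Set.range f)

theorem SpannedBy.mono {M N : Submodule K R} {n : ℕ} (h : SpannedBy N n) (hMN : M ≤ N) :
    SpannedBy M n :=
  h.imp fun _ hf => hMN.trans hf

theorem SpannedBy.mul {M N : Submodule K R} {m n : ℕ} (hM : SpannedBy M m) (hN : SpannedBy N n) :
    SpannedBy (M * N) (m * n) := by
  obtain ⟨f, hf⟩ := hM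
  obtain ⟨g, hg⟩ := hN
  refine ⟨fun k => f (finProdFinEquiv.symm k).1 * g (finProdFinEquiv.symm k).2, ?_⟩
  refine (mul_le_mul' hf hg).trans ?_
  rw [Submodule.span_mul_span, Submodule.span_le]
  rintro _ ⟨_, ⟨i, rfl⟩, _, ⟨j, rfl⟩, rfl⟩
  exact Submodule.subset_span ⟨finProdFinEquiv (i, j), by simp⟩

theorem SpannedBy.finrank_le {n : ℕ} (h : SpannedBy (⊤ : Submodule K R) n) :
    Module.Finite K R ∧ Module.finrank K R ≤ n := by
  obtain ⟨f, hf⟩ := h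
  have hf' : Submodule.span K (Set.range f) = ⊤ := top_le_iff.1 hf
  refine ⟨Module.finite_def.2 (hf' ▸ Submodule.fg_span (Set.finite_range f)), ?_⟩
  have := finrank_range_le_card (R := K) f
  rwa [Set.finrank, hf', finrank_top, Fintype.card_fin] at this

theorem adjoin_le_of_mul_mem {G : Set R} {M : Submodule K R} (h1 : (1 : R) ∈ M)
    (hG : ∀ m ∈ M, ∀ g ∈ G, m * g ∈ M) : Subalgebra.toSubmodule (Algebra.adjoin K G) ≤ M := by
  intro x hx
  rw [Subalgebra.mem_toSubmodule] at hx
  suffices h : ∀ m ∈ M, m * x ∈ M by simpa using h 1 h1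
  induction hx using Algebra.adjoin_induction with
  | mem g hg => exact fun m hm => hG m hm g hg
  | algebraMap r =>
    intro m hm
    rw [← Algebra.commutes, ← Algebra.smul_def]
    exact M.smul_mem r hm
  | add x y _ _ hx hy => exact fun m hm => mul_add m x y ▸ M.add_mem (hx m hm) (hy m hm)
  | mul x y _ _ hx hy => exact fun m hm => mul_assoc m x y ▸ hy _ (hx m hm)

/-- The straightening device: if t can be moved to the right past the generators, up to terms
without t, it can be moved past the subalgebra. -/
theorem mul_adjoin_mem {G : Set R} {t : R}
    (hG : ∀ g ∈ G, ∃ p ∈ Algebra.adjoin K G, ∃ q ∈ Algebra.adjoin K G, t * g = p * t + q) :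
    ∀ x ∈ Algebra.adjoin K G,
      ∃ p ∈ Algebra.adjoin K G, ∃ q ∈ Algebra.adjoin K G, t * x = p * t + q := by
  intro x hx
  induction hx using Algebra.adjoin_induction with
  | mem g hg => exact hG g hg
  | algebraMap r =>
    exact ⟨_, Subalgebra.algebraMap_mem _ r, 0, Subalgebra.zero_mem _, by
      rw [add_zero, Algebra.commutes]⟩
  | add x y _ _ hx hy =>
    obtain ⟨p, hp, q, hq, h⟩ := hx
    obtain ⟨p', hp', q', hq', h'⟩ := hy
    exact ⟨p + p', Subalgebra.add_mem _ hp hp', q + q', Subalgebra.add_mem _ hq hq', by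
      rw [mul_add, h, h']; noncomm_ring⟩
  | mul x y _ hy0 hx hy =>
    obtain ⟨p, hp, q, hq, h⟩ := hx
    obtain ⟨p', hp', q', hq', h'⟩ := hy
    refine ⟨p * p', Subalgebra.mul_mem _ hp hp', p * q' + q * y,
      Subalgebra.add_mem _ (Subalgebra.mul_mem _ hp hq') (Subalgebra.mul_mem _ hq hy0), ?_⟩
    rw [← mul_assoc, h, add_mul, mul_assoc p, h']
    noncomm_ring

/-- The six words are reduced words of 𝕊₃: the relations rewrite bab and abab by shorter words or by
aba. -/
theorem adjoin_pair_spannedBy {a b : R} (ha : a * a = 1) (hb : b * b = 1)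
    (hab : a * b * a + b * a * b = a + b) :
    SpannedBy (Subalgebra.toSubmodule (Algebra.adjoin K ({a, b} : Set R))) 6 := by
  refine ⟨![1, a, b, a * b, b * a, a * b * a], ?_⟩
  set M := Submodule.span K (Set.range ![1, a, b, a * b, b * a, a * b * a]) with hM
  have hm : ∀ i, ![1, a, b, a * b, b * a, a * b * a] i ∈ M := fun i =>
    Submodule.subset_span ⟨i, rfl⟩
  have m0 : 1 ∈ M := hm 0
  have m1 : a ∈ M := hm 1
  have m2 : b ∈ M := hm 2
  have m3 : a * b ∈ M := hm 3
  have m4 : b * a ∈ M := hm 4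
  have m5 : a * b * a ∈ M := hm 5
  refine adjoin_le_of_mul_mem m0 fun m hmM g hg => ?_
  induction hmM using Submodule.span_induction with
  | zero => rw [zero_mul]; exact M.zero_mem
  | add x y _ _ hx hy => rw [add_mul]; exact M.add_mem hx hy
  | smul c x _ hx => rw [smul_mul_assoc]; exact M.smul_mem c hx
  | mem x hx =>
    obtain ⟨i, rfl⟩ := hx
    have bab : b * a * b = a + b - a * b * a := by rw [← hab]; abel
    have abab : a * b * a * b = 1 + a * b - b * a := by
      linear_combination (norm := noncomm_ring) a * bab + ha - ha * b * a
    have aa : ∀ x, x * a * a = x := fun x => by rw [mul_assoc, ha, mul_one]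
    have bb : ∀ x, x * b * b = x := fun x => by rw [mul_assoc, hb, mul_one]
    rcases hg with rfl | rfl <;> fin_cases i
    all_goals simp only [Fin.zero_eta, Fin.mk_one, Fin.reduceFinMk, Matrix.cons_val, one_mul, aa, bb,
      ha, hb, abab, bab, m0, m1, m2, m3, m4, m5]
    · exact M.sub_mem (M.add_mem m1 m2) m5
    · exact M.sub_mem (M.add_mem m0 m3) m4

/-- Here 48 = 6·8. The subalgebra of a, b acts from the left on eight representatives, and it
suffices that a representative times a generator returns to their left span. -/
theorem adjoin_triple_spannedBy {a b c : R} (ha : a * a = 1) (hb : b * b = 1) (hc : c * c = 1)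
    (hab : a * b * a + b * a * b = a + b) (hac : a * c * a + c * a * c = a + c)
    (hbc : b * c * b + c * b * c = b + c)
    (h1 : a * b * c * a + b * c * a * b + c * a * b * c = a * b + b * c + c * a)
    (h2 : b * a * c * b + a * c * b * a + c * b * a * c = b * a + a * c + c * b) :
    SpannedBy (Subalgebra.toSubmodule (Algebra.adjoin K ({a, b, c} : Set R))) 48 := by
  set A := Algebra.adjoin K ({a, b} : Set R) with hA
  have Aa : a ∈ A := Algebra.subset_adjoin (by simp)
  have Ab : b ∈ A := Algebra.subset_adjoin (by simp)
  have A1 : (1 : R) ∈ A := A.one_mem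
  have Aab : a * b ∈ A := A.mul_mem Aa Ab
  have Aba : b * a ∈ A := A.mul_mem Ab Aa
  have Aaba : a * b * a ∈ A := A.mul_mem Aab Aa
  set V := Submodule.span K (Set.range ![1, c, c * a, c * b, c * a * b, c * b * a, c * a * b * a,
    c * a * b * a * c]) with hV
  have hv : ∀ i, ![1, c, c * a, c * b, c * a * b, c * b * a, c * a * b * a,
      c * a * b * a * c] i ∈ V := fun i => Submodule.subset_span ⟨i, rfl⟩
  set M := Subalgebra.toSubmodule A * V with hM
  have mm : ∀ {h v : R}, h ∈ A → v ∈ V → h * v ∈ M := fun h1 h2 => Submodule.mul_mem_mul h1 h2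
  have m1 : ∀ {v : R}, v ∈ V → v ∈ M := fun h => by simpa using mm A1 h
  have m0 : ∀ {h : R}, h ∈ A → h ∈ M := fun h => by simpa using mm h (hv 0)
  refine SpannedBy.mono (N := M) ((adjoin_pair_spannedBy ha hb hab).mul ⟨_, le_rfl⟩) ?_
  refine adjoin_le_of_mul_mem (m0 A1) fun m hmM g hg => ?_
  refine Submodule.mul_induction_on hmM (fun h hh v hvV => ?_) (fun x y hx hy => ?_)
  swap
  · rw [add_mul]; exact M.add_mem hx hy
  suffices hs : v * g ∈ M by
    rw [mul_assoc]
    refine Submodule.mul_induction_on hs (fun h' hh' v' hv' => ?_) (fun x y hx hy => ?_)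
    · rw [← mul_assoc]; exact mm (A.mul_mem hh hh') hv'
    · rw [mul_add]; exact M.add_mem hx hy
  induction hvV using Submodule.span_induction with
  | zero => rw [zero_mul]; exact M.zero_mem
  | add x y _ _ hx hy => rw [add_mul]; exact M.add_mem hx hy
  | smul r x _ hx => rw [smul_mul_assoc]; exact M.smul_mem r hx
  | mem x hx =>
    obtain ⟨i, rfl⟩ := hx
    have aa : ∀ x, x * a * a = x := fun x => by rw [mul_assoc, ha, mul_one]
    have bb : ∀ x, x * b * b = x := fun x => by rw [mul_assoc, hb, mul_one]
    have cc : ∀ x, x * c * c = x := fun x => by rw [mul_assoc, hc, mul_one]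
    have v1 : c ∈ V := hv 1
    have v2 : c * a ∈ V := hv 2
    have v3 : c * b ∈ V := hv 3
    have v4 : c * a * b ∈ V := hv 4
    have v5 : c * b * a ∈ V := hv 5
    have v6 : c * a * b * a ∈ V := hv 6
    have v7 : c * a * b * a * c ∈ V := hv 7
    have e1 : c * b * a * b = c * a + c * b - c * a * b * a := by
      linear_combination (norm := noncomm_ring) c * hab
    have e2 : c * a * b * a * b = c + c * a * b - c * b * a := by
      linear_combination (norm := noncomm_ring) c * a * hab + c * ha - c * ha * b * a
    have e3 : c * a * c = a + c - a * (c * a) := by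
      linear_combination (norm := noncomm_ring) hac
    have e4 : c * b * c = b + c - b * (c * b) := by
      linear_combination (norm := noncomm_ring) hbc
    have e5 : c * a * b * c = a * b + b * c + c * a - a * b * (c * a) - b * (c * a * b) := by
      linear_combination (norm := noncomm_ring) h1
    have e6 : c * b * a * c = b * a + a * c + c * b - b * a * (c * b) - a * (c * b * a) := by
      linear_combination (norm := noncomm_ring) h2
    -- The longest representative times a or b. For a, the tail aca is rewritten by `hac` and then
    -- cabc by `h1`; for b, the tail bacb is rewritten by `h2` and then cac by `hac`.
    have e7 : c * a * b * a * c * a = c * a * b * a + b * (c * a * b * a * c) - a * b * a * c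
        - b * (c * a * b) - a * b * (c * a) + c * a + a * b + a * b + b * a * (c * a) - b * a
        - 1 := by
      linear_combination (norm := noncomm_ring) c * a * b * hac - h1 * a * c + h1 - b * hac
        + a * b * c * ha * c + a * b * hc - c * ha * c - hc
    have e8 : c * a * b * a * c * b = a * (c * a * b * a * c) - a * b * a * c + b * a * (c * b)
        + a * (c * b * a) - b * a - b * a - a * c - a * (c * a * b) + a * b + c * a * b * a
        + 1 := by
      linear_combination (norm := noncomm_ring) c * a * h2 - hac * b * a * c - h2 + hac * b
        - c * ha * c * b * a - hc * b * a + c * ha * c + hc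
    rcases hg with rfl | rfl | rfl <;> fin_cases i
    all_goals simp only [Fin.zero_eta, Fin.mk_one, Fin.reduceFinMk, Matrix.cons_val, one_mul, aa, bb,
      cc, hc, m0 Aa, m0 Ab, m0 A1, m1 v1, m1 v2, m1 v3, m1 v4, m1 v5, m1 v6, m1 v7, e1, e2,
      e3, e4, e5, e6, e7, e8]
    all_goals repeat' first | refine M.sub_mem ?_ ?_ | refine M.add_mem ?_ ?_
    all_goals
      first
        | exact m0 (by assumption)
        | exact m1 (by assumption)
        | exact mm (by assumption) (by assumption)

/-- The relations of the deformed Fomin-Kirillov algebra, with parameters `1` and `-1`. -/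
structure FKRelations {n : ℕ} (y : Fin n → Fin n → R) : Prop where
  antisymm : ∀ i j, i ≠ j → y i j = -y j i
  sq : ∀ i j, i ≠ j → y i j * y i j = 1
  comm : ∀ i j k l, i ≠ j → k ≠ l → i ≠ k → i ≠ l → j ≠ k → j ≠ l → y i j * y k l = y k l * y i j
  triangle : ∀ i j k, i ≠ j → j ≠ k → k ≠ i →
    y i j * y j k + y j k * y k i + y k i * y i j = -1

/-! ### Consequences of the relations of Λ -/

namespace FKRelations

variable {n : ℕ} {y : Fin n → Fin n → R} (H : FKRelations y)

include H

theorem mul_eq {i j k : Fin n} (hij : i ≠ j) (hik : i ≠ k) (hjk : j ≠ k) :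
    y i j * y j k = y j k * y i k + y i k * y i j - 1 := by
  have h := H.triangle i j k hij hjk hik.symm
  rw [H.antisymm k i hik.symm] at h
  linear_combination (norm := noncomm_ring) h

theorem mul_eq' {i j k : Fin n} (hij : i ≠ j) (hik : i ≠ k) (hjk : j ≠ k) :
    y i j * y i k = y j k * y i j - y i k * y j k + 1 := by
  have h := H.mul_eq hij.symm hjk hik
  rw [H.antisymm j i hij.symm] at h
  linear_combination (norm := noncomm_ring) -h

/-- Multiply `mul_eq'` by y_{ik} on the right and by y_{jk} on the left. After the squares are
removed, y_{ij} cancels in the sum. -/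
theorem braid {i j k : Fin n} (hij : i ≠ j) (hik : i ≠ k) (hjk : j ≠ k) :
    y i k * y j k * y i k + y j k * y i k * y j k = y i k + y j k := by
  have h := H.mul_eq' hij hik hjk
  linear_combination (norm := noncomm_ring) h * y i k + y j k * h - y i j * H.sq i k hik
    + H.sq j k hjk * y i j

/-- Obtained by moving u = y_{ij} through the braid relation of b = y_{jk} and c = y_{mk}: u
commutes with c, and ub = au + ba − 1 trades b for a = y_{ik}. -/
theorem cyclic {i j m k : Fin n} (hij : i ≠ j) (hik : i ≠ k) (hjk : j ≠ k) (him : i ≠ m)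
    (hjm : j ≠ m) (hmk : m ≠ k) :
    y j k * y i k * y m k * y j k + y i k * y m k * y j k * y i k
      + y m k * y j k * y i k * y m k = y j k * y i k + y i k * y m k + y m k * y j k := by
  have hU := H.mul_eq hij hik hjk
  have hN := H.comm i j m k hij hmk him hik hjm hjk
  have hbc := H.braid hjm hjk hmk
  have hac := H.braid him hik hmk
  have hc := H.sq m k hmk
  set a := y i k
  set b := y j k
  set c := y m k
  set u := y i j
  linear_combination (norm := noncomm_ring) u * hbc - hU * c * b - a * hN * b - a * c * hU
    - hN * b * c - c * hU * c - c * a * hN + hU + hN - hac * u + hc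

end FKRelations

/-- Sort by the larger index: the algebra of the y_{i3} (48 elements), that of the y_{i2} (6
elements), then 1 and y_{01}. Left multiplication by a generator preserves the product of these
spaces, because y_{ij} can be moved past the y_{k3}, and y_{01} past the y_{k2}. -/
theorem FKRelations.spannedBy {y : Fin 4 → Fin 4 → R} (H : FKRelations y)
    (hgen : ∀ M : Submodule K R, 1 ∈ M → (∀ i j, i ≠ j → ∀ m ∈ M, y i j * m ∈ M) → M = ⊤) :
    SpannedBy (⊤ : Submodule K R) 576 := by
  set A := Algebra.adjoin K ({y 0 3, y 1 3, y 2 3} : Set R) with hA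
  set B := Algebra.adjoin K ({y 0 2, y 1 2} : Set R) with hB
  set V := Submodule.span K (Set.range ![1, y 0 1]) with hV
  have hA48 : SpannedBy (Subalgebra.toSubmodule A) 48 := by
    refine adjoin_triple_spannedBy (H.sq _ _ (by decide)) (H.sq _ _ (by decide))
      (H.sq _ _ (by decide)) (H.braid (by decide) (by decide) (by decide))
      (H.braid (by decide) (by decide) (by decide)) (H.braid (by decide) (by decide) (by decide))
      ?_ ?_
    -- The two four-letter relations are the cyclic relation for the two orders of the indices 0 and
    -- 1.
    · linear_combination (norm := noncomm_ring) H.cyclic (i := 1) (j := 0) (m := 2) (k := 3)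
        (by decide) (by decide) (by decide) (by decide) (by decide) (by decide)
    · exact H.cyclic (by decide) (by decide) (by decide) (by decide) (by decide) (by decide)
  have hB6 : SpannedBy (Subalgebra.toSubmodule B) 6 :=
    adjoin_pair_spannedBy (H.sq _ _ (by decide)) (H.sq _ _ (by decide))
      (H.braid (by decide) (by decide) (by decide))
  have hV2 : SpannedBy V 2 := ⟨_, le_rfl⟩
  have hv0 : 1 ∈ V := Submodule.subset_span ⟨0, rfl⟩
  have hv1 : y 0 1 ∈ V := Submodule.subset_span ⟨1, rfl⟩
  have hAg : ∀ i : Fin 4, i ≠ 3 → y i 3 ∈ A := by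
    intro i hi
    refine Algebra.subset_adjoin ?_
    fin_cases i <;> simp at hi ⊢
  have hBg : ∀ i : Fin 4, i ≠ 3 → i ≠ 2 → y i 2 ∈ B := by
    intro i hi hi'
    refine Algebra.subset_adjoin ?_
    fin_cases i <;> simp at hi hi' ⊢
  set P := Subalgebra.toSubmodule B * V with hP
  have hP01 : ∀ m ∈ P, y 0 1 * m ∈ P := by
    intro m hm
    refine Submodule.mul_induction_on hm (fun b hb v hv => ?_) (fun p q hp hq => ?_)
    · obtain ⟨p, hp, q, hq, h⟩ := mul_adjoin_mem (K := K) (G := {y 0 2, y 1 2}) (t := y 0 1) (by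
        rintro g (rfl | rfl)
        · refine ⟨y 1 2, hBg 1 (by decide) (by decide), 1 - y 0 2 * y 1 2, B.sub_mem B.one_mem
            (B.mul_mem (hBg 0 (by decide) (by decide)) (hBg 1 (by decide) (by decide))), ?_⟩
          rw [H.mul_eq' (by decide) (by decide) (by decide)]
          noncomm_ring
        · refine ⟨y 0 2, hBg 0 (by decide) (by decide), y 1 2 * y 0 2 - 1, B.sub_mem
            (B.mul_mem (hBg 1 (by decide) (by decide)) (hBg 0 (by decide) (by decide)))
              B.one_mem, ?_⟩
          rw [H.mul_eq (by decide) (by decide) (by decide)]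
          noncomm_ring) b hb
      rw [← mul_assoc, h, add_mul, mul_assoc]
      refine P.add_mem (Submodule.mul_mem_mul hp ?_) (Submodule.mul_mem_mul hq hv)
      induction hv using Submodule.span_induction with
      | zero => rw [mul_zero]; exact V.zero_mem
      | add x y _ _ hx hy => rw [mul_add]; exact V.add_mem hx hy
      | smul r x _ hx => rw [mul_smul_comm]; exact V.smul_mem r hx
      | mem x hx =>
        obtain ⟨i, rfl⟩ := hx
        fin_cases i
        · simpa using hv1
        · simpa [H.sq 0 1 (by decide)] using hv0
    · rw [mul_add]; exact P.add_mem hp hq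
  have hPi2 : ∀ i : Fin 4, i ≠ 3 → i ≠ 2 → ∀ m ∈ P, y i 2 * m ∈ P := by
    intro i hi hi' m hm
    refine Submodule.mul_induction_on hm (fun b hb v hv => ?_) (fun p q hp hq => ?_)
    · rw [← mul_assoc]
      exact Submodule.mul_mem_mul (B.mul_mem (hBg i hi hi') hb) hv
    · rw [mul_add]; exact P.add_mem hp hq
  have hPij : ∀ i j : Fin 4, i < j → j ≠ 3 → ∀ m ∈ P, y i j * m ∈ P := by
    intro i j hij hj
    obtain ⟨rfl, rfl⟩ | ⟨hi, rfl⟩ : (i = 0 ∧ j = 1) ∨ ((i ≠ 3 ∧ i ≠ 2) ∧ j = 2) := by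
      revert i j; decide
    · exact hP01
    · exact hPi2 i hi.1 hi.2
  set M := Subalgebra.toSubmodule A * P with hM
  have hMtop : M = ⊤ := by
    have hlt : ∀ i j : Fin 4, i < j → ∀ m ∈ M, y i j * m ∈ M := by
      intro i j hij m hm
      refine Submodule.mul_induction_on hm (fun a ha v hv => ?_) (fun p q hp hq => ?_)
      · by_cases hj : j = 3
        · subst hj
          rw [← mul_assoc]
          exact Submodule.mul_mem_mul (A.mul_mem (hAg i hij.ne) ha) hv
        · have hi : i ≠ 3 := by rintro rfl; revert j; decide
          obtain ⟨p, hp, q, hq, h⟩ := mul_adjoin_mem (K := K) (G := {y 0 3, y 1 3, y 2 3})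
            (t := y i j) (by
              intro g hg
              obtain ⟨k, hk, rfl⟩ : ∃ k : Fin 4, k ≠ 3 ∧ g = y k 3 := by
                rcases hg with rfl | rfl | rfl
                exacts [⟨0, by decide, rfl⟩, ⟨1, by decide, rfl⟩, ⟨2, by decide, rfl⟩]
              by_cases hik : k = i
              · subst hik
                refine ⟨y j 3, hAg j hj, 1 - y k 3 * y j 3,
                  A.sub_mem A.one_mem (A.mul_mem (hAg k hk) (hAg j hj)), ?_⟩
                rw [H.mul_eq' hij.ne hk hj]
                noncomm_ring
              by_cases hjk : k = j
              · subst hjk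
                refine ⟨y i 3, hAg i hi, y k 3 * y i 3 - 1,
                  A.sub_mem (A.mul_mem (hAg k hk) (hAg i hi)) A.one_mem, ?_⟩
                rw [H.mul_eq hij.ne hi hk]
                noncomm_ring
              · exact ⟨y k 3, hAg k hk, 0, A.zero_mem, by
                  rw [add_zero, H.comm i j k 3 hij.ne hk (Ne.symm hik) hi (Ne.symm hjk) hj]⟩)
            a ha
          rw [← mul_assoc, h, add_mul, mul_assoc]
          exact M.add_mem (Submodule.mul_mem_mul hp (hPij i j hij hj v hv))
            (Submodule.mul_mem_mul hq hv)
      · rw [mul_add]; exact M.add_mem hp hq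
    refine hgen M ?_ fun i j hij m hm => ?_
    · have h1 : (1 : R) ∈ P := by simpa using Submodule.mul_mem_mul B.one_mem hv0
      simpa using Submodule.mul_mem_mul A.one_mem h1
    · rcases lt_or_gt_of_ne hij with h | h
      · exact hlt i j h m hm
      · rw [H.antisymm i j hij, neg_mul]
        exact M.neg_mem (hlt j i h m hm)
  rw [← hMtop]
  exact hA48.mul (hB6.mul hV2)

end Span

/-! ### The structure of `𝒟₄(α, -α)` -/

section Structure

open GeodesicAlgebra

variable {K : Type*} [Field K] {α β : K}

theorem DFK.submodule_eq_top {n : ℕ} {α₁ α₂ : K} (M : Submodule K (DFK K n α₁ α₂)) (h1 : 1 ∈ M)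
    (hM : ∀ p, ∀ m ∈ M, DFK.gen α₁ α₂ p * m ∈ M) : M = ⊤ := by
  let mk : FreeAlgebra K (OffDiag n) →ₐ[K] DFK K n α₁ α₂ := RingQuot.mkAlgHom K _
  refine Submodule.eq_top_iff'.2 fun x => ?_
  obtain ⟨x, rfl⟩ : ∃ y, mk y = x := RingQuot.mkAlgHom_surjective K (DFKRel K n α₁ α₂) x
  suffices h : ∀ m ∈ M, mk x * m ∈ M by simpa using h 1 h1
  induction x using FreeAlgebra.induction with
  | grade0 r =>
    intro m hm
    rw [AlgHom.commutes, ← Algebra.smul_def]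
    exact M.smul_mem r hm
  | grade1 p => exact fun m hm => hM p m hm
  | mul a b ha hb =>
    intro m hm
    rw [map_mul, mul_assoc]
    exact ha _ (hb m hm)
  | add a b ha hb =>
    intro m hm
    rw [map_add, add_mul]
    exact M.add_mem (ha m hm) (hb m hm)

theorem DFK.gen_antisymm {n : ℕ} {α₁ α₂ : K} {i j : Fin n} (h : i ≠ j) :
    DFK.gen α₁ α₂ ⟨(i, j), h⟩ = -DFK.gen α₁ α₂ ⟨(j, i), h.symm⟩ := by
  have := RingQuot.mkAlgHom_rel K (DFKRel.antisymm (K := K) (α₁ := α₁) (α₂ := α₂) i j h)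
  rw [map_neg] at this
  exact this

theorem DFK.gen_sq {n : ℕ} {α₁ α₂ : K} {i j : Fin n} (h : i ≠ j) :
    DFK.gen α₁ α₂ ⟨(i, j), h⟩ * DFK.gen α₁ α₂ ⟨(i, j), h⟩ = algebraMap K _ α₁ := by
  have := RingQuot.mkAlgHom_rel K (DFKRel.sq (K := K) (α₁ := α₁) (α₂ := α₂) i j h)
  rw [map_mul, AlgHom.commutes] at this
  exact this

theorem DFK.gen_comm {n : ℕ} {α₁ α₂ : K} {i j k l : Fin n} (hij : i ≠ j) (hkl : k ≠ l)
    (hik : i ≠ k) (hil : i ≠ l) (hjk : j ≠ k) (hjl : j ≠ l) :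
    DFK.gen α₁ α₂ ⟨(i, j), hij⟩ * DFK.gen α₁ α₂ ⟨(k, l), hkl⟩
      = DFK.gen α₁ α₂ ⟨(k, l), hkl⟩ * DFK.gen α₁ α₂ ⟨(i, j), hij⟩ := by
  have := RingQuot.mkAlgHom_rel K
    (DFKRel.comm (K := K) (α₁ := α₁) (α₂ := α₂) i j k l hij hkl hik hil hjk hjl)
  rw [map_mul, map_mul] at this
  exact this

theorem DFK.gen_triangle {n : ℕ} {α₁ α₂ : K} {i j k : Fin n} (hij : i ≠ j) (hjk : j ≠ k)
    (hki : k ≠ i) :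
    DFK.gen α₁ α₂ ⟨(i, j), hij⟩ * DFK.gen α₁ α₂ ⟨(j, k), hjk⟩
      + DFK.gen α₁ α₂ ⟨(j, k), hjk⟩ * DFK.gen α₁ α₂ ⟨(k, i), hki⟩
      + DFK.gen α₁ α₂ ⟨(k, i), hki⟩ * DFK.gen α₁ α₂ ⟨(i, j), hij⟩ = algebraMap K _ α₂ := by
  have := RingQuot.mkAlgHom_rel K
    (DFKRel.triangle (K := K) (α₁ := α₁) (α₂ := α₂) i j k hij hjk hki)
  rw [map_add, map_add, map_mul, map_mul, map_mul, AlgHom.commutes] at this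
  exact this

/-- The generators `β⁻¹ x_{ij}`. -/
noncomputable def normGen (α β : K) {n : ℕ} (i j : Fin n) : DFK K n α (-α) :=
  if h : i ≠ j then β⁻¹ • DFK.gen α (-α) ⟨(i, j), h⟩ else 0

theorem normGen_relations (hα : α ≠ 0) (hβ : β ^ 2 = α) (n : ℕ) :
    FKRelations (normGen α β : Fin n → Fin n → _) := by
  have hβ0 : β ≠ 0 := by rintro rfl; exact hα (by rw [← hβ]; simp)
  have hβα : β⁻¹ * β⁻¹ * α = 1 := by rw [← hβ]; field_simp
  refine ⟨fun i j h => ?_, fun i j h => ?_, fun i j k l hij hkl hik hil hjk hjl => ?_,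
    fun i j k hij hjk hki => ?_⟩
  · rw [normGen, normGen, dif_pos h, dif_pos h.symm, DFK.gen_antisymm h, smul_neg]
  · rw [normGen, dif_pos h, smul_mul_smul_comm, DFK.gen_sq, Algebra.algebraMap_eq_smul_one,
      smul_smul, hβα, one_smul]
  · rw [normGen, normGen, dif_pos hij, dif_pos hkl, smul_mul_smul_comm, smul_mul_smul_comm,
      DFK.gen_comm hij hkl hik hil hjk hjl]
  · rw [normGen, normGen, normGen, dif_pos hij, dif_pos hjk, dif_pos hki, smul_mul_smul_comm,
      smul_mul_smul_comm, smul_mul_smul_comm, ← smul_add, ← smul_add,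
      DFK.gen_triangle hij hjk hki, Algebra.algebraMap_eq_smul_one, smul_smul, mul_neg, hβα,
      neg_smul, one_smul]

theorem DFK.finrank_le (hα : α ≠ 0) (hβ : β ^ 2 = α) :
    Module.Finite K (DFK K 4 α (-α)) ∧ Module.finrank K (DFK K 4 α (-α)) ≤ 576 := by
  have hβ0 : β ≠ 0 := by rintro rfl; exact hα (by rw [← hβ]; simp)
  refine ((normGen_relations hα hβ 4).spannedBy fun M h1 hM => ?_).finrank_le
  refine DFK.submodule_eq_top M h1 fun ⟨⟨i, j⟩, h⟩ m hm => ?_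
  have := M.smul_mem β (hM i j h m hm)
  rwa [normGen, dif_pos h, smul_mul_assoc, smul_smul, mul_inv_cancel₀ hβ0, one_smul] at this

/-- A surjection onto a space of dimension 576 from one of dimension at most 576. -/
theorem ofDFK_bijective [CharZero K] (hα : α ≠ 0) (hβ : β ^ 2 = α) :
    Function.Bijective (ofDFK hβ) := by
  have hs : Function.Surjective (ofDFK hβ) := AlgHom.range_eq_top _ |>.1 (ofDFK_range hα hβ)
  obtain ⟨hfin, hle⟩ := DFK.finrank_le hα hβ
  have hB : Module.finrank K (PermAlgebra K) = 576 := by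
    rw [GeodesicAlgebra.finrank_eq, Fintype.card_perm, Fintype.card_fin]
    rfl
  have hge := LinearMap.finrank_le_finrank_of_surjective (f := (ofDFK hβ).toLinearMap) hs
  refine ⟨?_, hs⟩
  exact (LinearMap.injective_iff_surjective_of_finrank_eq_finrank
    (f := (ofDFK hβ).toLinearMap) (by omega)).2 hs

/-- The isomorphism between `𝒟₄(α, -α)` and the geodesic algebra. -/
noncomputable def dfkEquiv [CharZero K] (hα : α ≠ 0) (hβ : β ^ 2 = α) :
    DFK K 4 α (-α) ≃ₐ[K] PermAlgebra K :=
  AlgEquiv.ofBijective (ofDFK hβ) (ofDFK_bijective hα hβ)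

theorem dfkEquiv_diag [CharZero K] (hα : α ≠ 0) (hβ : β ^ 2 = α) (σ : Equiv.Perm (Fin 4))
    (x : DFK K 4 α (-α)) : dfkEquiv hα hβ x σ σ = rho hβ σ x := by
  rw [← diag_comp_ofDFK]
  rfl

theorem nonempty_vertexSystem [CharZero K] (hα : α ≠ 0) (hβ : β ^ 2 = α) :
    Nonempty (VertexSystem hβ) :=
  ⟨{ e := fun σ => (dfkEquiv hα hβ).symm (unit σ σ)
     complete := completeOrthogonalIdempotents_unit.map
       ((dfkEquiv hα hβ).symm : PermAlgebra K →+* DFK K 4 α (-α))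
     primitive := fun σ =>
       isPrimitiveIdempotent_of_map_eq_unit (dfkEquiv hα hβ) (AlgEquiv.apply_symm_apply _ _)
     rho_e := fun σ τ => by
       rw [← dfkEquiv_diag hα hβ, AlgEquiv.apply_symm_apply, unit_apply]
       simp }⟩

/-- Conjugation by a unit. -/
def unitConj {A : Type*} [Ring A] [Algebra K A] (u : Aˣ) : A ≃ₐ[K] A where
  toFun a := ↑u⁻¹ * a * u
  invFun a := u * a * ↑u⁻¹
  left_inv a := by simp [mul_assoc]
  right_inv a := by simp [mul_assoc]
  map_mul' a b := by simp [mul_assoc]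
  map_add' a b := by simp [mul_add, add_mul]
  commutes' r := by rw [← Algebra.commutes, mul_assoc, Units.inv_mul, mul_one]

/-- The values ρ_σ(e_τ) are the diagonal entries, so `exists_conj` applies. This reduces an
arbitrary system of idempotents to the E_{σσ}. -/
theorem exists_equiv_vertexSystem [CharZero K] (hα : α ≠ 0) {hβ : β ^ 2 = α}
    (V : VertexSystem hβ) :
    ∃ φ : DFK K 4 α (-α) ≃ₐ[K] PermAlgebra K, ∀ σ, φ (V.e σ) = unit σ σ := by
  obtain ⟨u, hu⟩ := exists_conj
    (V.complete.map (dfkEquiv hα hβ : DFK K 4 α (-α) →+* PermAlgebra K))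
    (fun σ τ => (dfkEquiv_diag hα hβ σ (V.e τ)).trans (V.rho_e σ τ))
  refine ⟨(dfkEquiv hα hβ).trans (unitConj u), fun σ => ?_⟩
  have h : dfkEquiv hα hβ (V.e σ) * (u : PermAlgebra K) = (u : PermAlgebra K) * unit σ σ := hu σ
  change (↑u⁻¹ : PermAlgebra K) * dfkEquiv hα hβ (V.e σ) * (u : PermAlgebra K) = unit σ σ
  rw [mul_assoc, h, Units.inv_mul_cancel_left]

end Structure

/-! ### Arrows and paths -/

section Paths

open GeodesicAlgebra

variable {K : Type*} [Field K] {α β : K} {hβ : β ^ 2 = α} {V : VertexSystem hβ}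

theorem d_nonSimple_mul (σ : Equiv.Perm (Fin 4)) (i : Fin 3) :
    GeodesicSpace.d σ (nonSimple i * σ) = 1 := by
  rw [d_perm, mul_inv_cancel_right, skewLength_nonSimple]

/-- The arrows of the quiver that correspond to the matrix units of the geodesic algebra. -/
noncomputable def arrowSystem (φ : DFK K 4 α (-α) ≃ₐ[K] PermAlgebra K)
    (hφ : ∀ σ, φ (V.e σ) = unit σ σ) : ArrowSystem V where
  a σ i := φ.symm (unit σ (nonSimple i * σ))
  mem_rad σ i := by
    rw [mem_jacobson_iff φ, AlgEquiv.apply_symm_apply, ← d_nonSimple_mul σ i]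
    exact unit_mem_fil _ _
  left_e σ i := φ.injective <| by
    rw [map_mul, hφ, AlgEquiv.apply_symm_apply, unit_mul_unit,
      if_pos (by rw [GeodesicSpace.d_self, zero_add])]
  right_e σ i := φ.injective <| by
    rw [map_mul, hφ, AlgEquiv.apply_symm_apply, unit_mul_unit,
      if_pos (by rw [GeodesicSpace.d_self, add_zero])]
  notMem_rad_sq σ i := by
    rw [mem_jacobson_pow_iff φ, AlgEquiv.apply_symm_apply]
    intro h
    have := h σ (nonSimple i * σ) (by rw [d_nonSimple_mul]; omega)
    rw [unit_apply, if_pos ⟨rfl, rfl⟩] at this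
    exact one_ne_zero this
  spans σ τ x hx := by
    have hx' : φ (V.e σ * x * V.e τ) = φ x σ τ • unit σ τ := by
      rw [map_mul, map_mul, hφ, hφ]
      ext ρ π
      rw [mul_unit_apply, unit_mul_apply, GeodesicAlgebra.smul_apply, unit_apply]
      by_cases h1 : ρ = σ <;> by_cases h2 : π = τ <;> simp [h1, h2]
    rw [← φ.symm_apply_apply (V.e σ * x * V.e τ), hx', map_smul]
    -- At distance at least 2 the unit E_{στ} lies in the square of the radical, at distance 1 it is
    -- an arrow, and at distance 0 its coefficient vanishes for a radical element.
    by_cases h2 : 2 ≤ GeodesicSpace.d σ τ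
    · refine Submodule.mem_sup_right (Submodule.smul_mem _ _ ?_)
      rw [Submodule.restrictScalars_mem, mem_jacobson_pow_iff φ, AlgEquiv.apply_symm_apply]
      exact fil_anti h2 (unit_mem_fil σ τ)
    · by_cases h1 : GeodesicSpace.d σ τ = 1
      · obtain ⟨i, hi⟩ := eq_nonSimple_of_skewLength _ h1
        have hτ : nonSimple i * σ = τ := by rw [← hi, inv_mul_cancel_right]
        refine Submodule.mem_sup_left (Submodule.smul_mem _ _ (Submodule.subset_span ⟨i, hτ, ?_⟩))
        rw [hτ]
      · rw [(mem_jacobson_iff φ x).1 hx σ τ (by omega), zero_smul]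
        exact Submodule.zero_mem _

/-- The product of the transpositions along a path. -/
def wordPerm : List (Fin 3) → Equiv.Perm (Fin 4)
  | [] => 1
  | i :: w => wordPerm w * nonSimple i

theorem skewLength_wordPerm_le (w : List (Fin 3)) : skewLength (wordPerm w) ≤ w.length := by
  induction w with
  | nil => decide
  | cons i w ih =>
    have := skewLength_mul_le (wordPerm w) (nonSimple i)
    rw [skewLength_nonSimple] at this
    rw [wordPerm, List.length_cons]
    omega

/-- A product of unit steps survives exactly when the path is a geodesic, that is, when the word is
reduced. -/
theorem map_pathElem (φ : DFK K 4 α (-α) ≃ₐ[K] PermAlgebra K) (hφ : ∀ σ, φ (V.e σ) = unit σ σ)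
    (w : List (Fin 3)) (σ : Equiv.Perm (Fin 4)) :
    φ (pathElem (arrowSystem φ hφ) σ w) =
      if skewLength (wordPerm w) = w.length then unit σ (wordPerm w * σ) else 0 := by
  induction w generalizing σ with
  | nil => rw [pathElem, hφ, wordPerm, one_mul, if_pos (by decide)]
  | cons i w ih =>
    have h1 := skewLength_mul_le (wordPerm w) (nonSimple i)
    have h2 := skewLength_wordPerm_le w
    rw [skewLength_nonSimple] at h1
    rw [pathElem, map_mul, ih]
    change φ (φ.symm (unit σ (nonSimple i * σ))) * _ = _
    rw [AlgEquiv.apply_symm_apply, wordPerm, List.length_cons]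
    by_cases h : skewLength (wordPerm w) = w.length
    · rw [if_pos h, unit_mul_unit, d_nonSimple_mul, d_perm, d_perm, mul_inv_cancel_right,
        ← mul_assoc, mul_inv_cancel_right]
      refine if_congr ?_ rfl rfl
      omega
    -- A letter raises the length by at most 1, so a word with a nonreduced tail is not reduced.
    · rw [if_neg h, mul_zero, if_neg (by omega)]

theorem exists_reduced_word (w : Equiv.Perm (Fin 4)) :
    ∃ l : List (Fin 3), wordPerm l = w ∧ skewLength w = l.length := by
  induction hn : skewLength w generalizing w with
  | zero => exact ⟨[], (eq_one_of_skewLength w hn).symm, rfl⟩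
  | succ n ih =>
    obtain ⟨i, hi⟩ := exists_skewLength_mul_nonSimple w (by omega)
    obtain ⟨l, hl, hl'⟩ := ih (w * nonSimple i) (by omega)
    refine ⟨i :: l, ?_, by rw [List.length_cons, hl']⟩
    rw [wordPerm, hl, mul_assoc]
    nth_rw 1 [← nonSimple_inv i]
    rw [inv_mul_cancel, mul_one]

/-- A reduced word of a permutation. -/
noncomputable def redWord (w : Equiv.Perm (Fin 4)) : List (Fin 3) := (exists_reduced_word w).choose

theorem wordPerm_redWord (w : Equiv.Perm (Fin 4)) : wordPerm (redWord w) = w :=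
  (exists_reduced_word w).choose_spec.1

theorem length_redWord (w : Equiv.Perm (Fin 4)) : (redWord w).length = skewLength w :=
  (exists_reduced_word w).choose_spec.2.symm

end Paths

/-! ### The presented algebra -/

section Presented

open GeodesicAlgebra

variable {K : Type*} [Field K]

theorem presentedGen_sq (i : Fin 3) : presentedGen K i * presentedGen K i = 0 := by
  have := RingQuot.mkAlgHom_rel K (GrRel.sq (K := K) i)
  rwa [map_mul, map_zero] at this

theorem presentedGen_comm :
    presentedGen K 0 * presentedGen K 2 = presentedGen K 2 * presentedGen K 0 := by
  have := RingQuot.mkAlgHom_rel K (GrRel.comm (K := K))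
  rwa [map_mul, map_mul] at this

theorem presentedGen_braid (i : Fin 3) (hi : i ≠ 1) :
    presentedGen K i * presentedGen K 1 * presentedGen K i
      = presentedGen K 1 * presentedGen K i * presentedGen K 1 := by
  have := RingQuot.mkAlgHom_rel K (GrRel.braid (K := K) i hi)
  rwa [map_mul, map_mul, map_mul, map_mul] at this

theorem adjoin_presentedGen : Algebra.adjoin K (Set.range (presentedGen K)) = ⊤ := by
  have h : Set.range (presentedGen K)
      = RingQuot.mkAlgHom K (GrRel K) '' Set.range (FreeAlgebra.ι K) := by
    rw [← Set.range_comp]; rfl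
  rw [h, ← AlgHom.map_adjoin, FreeAlgebra.adjoin_range_ι, Algebra.map_top, AlgHom.range_eq_top]
  exact RingQuot.mkAlgHom_surjective K _

/-- Here 24 = 6·4: six words in s₁, s₂ times the coset words 1, s₃, s₃s₂, s₃s₂s₁, whose left span is
stable under right multiplication by the generators. -/
theorem presentedAlgebra_spannedBy : SpannedBy (⊤ : Submodule K (PresentedAlgebra K)) 24 := by
  have ha := presentedGen_sq (K := K) 0
  have hb := presentedGen_sq (K := K) 1
  have hc := presentedGen_sq (K := K) 2
  have hac := presentedGen_comm (K := K)
  have hab := presentedGen_braid (K := K) 0 (by decide)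
  have hcb := presentedGen_braid (K := K) 2 (by decide)
  have hgen := adjoin_presentedGen (K := K)
  have hrange : Set.range (presentedGen K) =
      {presentedGen K 0, presentedGen K 1, presentedGen K 2} := by
    ext x; simp [Fin.exists_fin_succ, eq_comm]
  rw [hrange] at hgen
  set a := presentedGen K 0
  set b := presentedGen K 1
  set c := presentedGen K 2
  set A := Algebra.adjoin K ({a, b} : Set (PresentedAlgebra K)) with hA
  have hA6 : SpannedBy (Subalgebra.toSubmodule A) 6 := by
    refine ⟨![1, a, b, a * b, b * a, a * b * a], ?_⟩
    set M := Submodule.span K (Set.range ![1, a, b, a * b, b * a, a * b * a]) with hM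
    have hm : ∀ i, ![1, a, b, a * b, b * a, a * b * a] i ∈ M := fun i =>
      Submodule.subset_span ⟨i, rfl⟩
    have m0 : 1 ∈ M := hm 0
    have m1 : a ∈ M := hm 1
    have m2 : b ∈ M := hm 2
    have m3 : a * b ∈ M := hm 3
    have m4 : b * a ∈ M := hm 4
    have m5 : a * b * a ∈ M := hm 5
    refine adjoin_le_of_mul_mem m0 fun m hmM g hg => ?_
    induction hmM using Submodule.span_induction with
    | zero => rw [zero_mul]; exact M.zero_mem
    | add x y _ _ hx hy => rw [add_mul]; exact M.add_mem hx hy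
    | smul c x _ hx => rw [smul_mul_assoc]; exact M.smul_mem c hx
    | mem x hx =>
      obtain ⟨i, rfl⟩ := hx
      have abab : a * b * a * b = 0 := by rw [hab, mul_assoc, hb, mul_zero]
      have aa : ∀ x, x * a * a = 0 := fun x => by rw [mul_assoc, ha, mul_zero]
      have bb : ∀ x, x * b * b = 0 := fun x => by rw [mul_assoc, hb, mul_zero]
      have m5' : b * a * b ∈ M := hab ▸ m5
      rcases hg with rfl | rfl <;> fin_cases i
      all_goals simp only [Fin.zero_eta, Fin.mk_one, Fin.reduceFinMk, Matrix.cons_val, one_mul, aa,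
        bb, ha, hb, abab, m1, m2, m3, m4, m5, m5', M.zero_mem]
  have Aa : a ∈ A := Algebra.subset_adjoin (by simp)
  have Ab : b ∈ A := Algebra.subset_adjoin (by simp)
  have A1 : (1 : PresentedAlgebra K) ∈ A := A.one_mem
  set V := Submodule.span K (Set.range ![1, c, c * b, c * b * a]) with hV
  have hv : ∀ i, ![1, c, c * b, c * b * a] i ∈ V := fun i => Submodule.subset_span ⟨i, rfl⟩
  set M := Subalgebra.toSubmodule A * V with hM
  have mm : ∀ {h v : PresentedAlgebra K}, h ∈ A → v ∈ V → h * v ∈ M :=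
    fun h1 h2 => Submodule.mul_mem_mul h1 h2
  have m1 : ∀ {v : PresentedAlgebra K}, v ∈ V → v ∈ M := fun h => by simpa using mm A1 h
  have m0 : ∀ {h : PresentedAlgebra K}, h ∈ A → h ∈ M := fun h => by simpa using mm h (hv 0)
  refine SpannedBy.mono (N := M) (hA6.mul (n := 4) ⟨_, le_rfl⟩) ?_
  rw [← Algebra.top_toSubmodule, ← hgen]
  refine adjoin_le_of_mul_mem (m0 A1) fun m hmM g hg => ?_
  refine Submodule.mul_induction_on hmM (fun h hh v hvV => ?_) (fun x y hx hy => ?_)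
  swap
  · rw [add_mul]; exact M.add_mem hx hy
  suffices hs : v * g ∈ M by
    rw [mul_assoc]
    refine Submodule.mul_induction_on hs (fun h' hh' v' hv' => ?_) (fun x y hx hy => ?_)
    · rw [← mul_assoc]; exact mm (A.mul_mem hh hh') hv'
    · rw [mul_add]; exact M.add_mem hx hy
  induction hvV using Submodule.span_induction with
  | zero => rw [zero_mul]; exact M.zero_mem
  | add x y _ _ hx hy => rw [add_mul]; exact M.add_mem hx hy
  | smul r x _ hx => rw [smul_mul_assoc]; exact M.smul_mem r hx
  | mem x hx =>
    obtain ⟨i, rfl⟩ := hx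
    have aa : ∀ x, x * a * a = 0 := fun x => by rw [mul_assoc, ha, mul_zero]
    have bb : ∀ x, x * b * b = 0 := fun x => by rw [mul_assoc, hb, mul_zero]
    have v1 : c ∈ V := hv 1
    have v2 : c * b ∈ V := hv 2
    have v3 : c * b * a ∈ V := hv 3
    have e1 : c * a = a * c := hac.symm
    have e2 : c * b * a * b = a * (c * b * a) := by
      linear_combination (norm := noncomm_ring) -(c * hab) - hac * b * a
    have e3 : c * b * c = b * (c * b) := by
      linear_combination (norm := noncomm_ring) hcb
    have e4 : c * b * a * c = b * (c * b * a) := by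
      linear_combination (norm := noncomm_ring) hcb * a + c * b * hac
    rcases hg with rfl | rfl | rfl <;> fin_cases i
    all_goals simp only [Fin.zero_eta, Fin.mk_one, Fin.reduceFinMk, Matrix.cons_val, one_mul, aa, bb,
      hc, m0 Aa, m0 Ab, m1 v1, m1 v2, m1 v3, e1, e2, e3, e4, mm Aa v1, mm Aa v3, mm Ab v2,
      mm Ab v3, M.zero_mem]

/-- The translation invariant element of the geodesic algebra attached to a permutation. -/
def shift (K : Type*) [Field K] (w : Equiv.Perm (Fin 4)) : PermAlgebra K :=
  fun σ τ => if τ = w * σ then 1 else 0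

theorem shift_apply (w σ τ : Equiv.Perm (Fin 4)) :
    shift K w σ τ = if τ = w * σ then 1 else 0 := rfl

/-- Steps multiply σ on the left, so the later factor v stands on the left in the product of
permutations. -/
theorem shift_mul_shift (u v : Equiv.Perm (Fin 4)) :
    shift K u * shift K v =
      if skewLength u + skewLength v = skewLength (v * u) then shift K (v * u) else 0 := by
  ext σ τ
  rw [mul_apply, Finset.sum_eq_single (u * σ)]
  · by_cases h : τ = v * u * σ
    · subst h
      rw [d_perm, d_perm, d_perm, mul_inv_cancel_right, mul_inv_cancel_right, mul_assoc v u σ,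
        mul_inv_cancel_right]
      split_ifs <;> simp [shift_apply, mul_assoc]
    · have h' : τ ≠ v * (u * σ) := by rwa [← mul_assoc]
      simp only [shift_apply, if_neg h', mul_zero, ite_self]
      split_ifs <;> simp [shift_apply, h]
  · intro ρ _ hρ
    simp [shift_apply, hρ]
  · simp

theorem shift_one : shift K 1 = 1 := by
  ext σ τ
  simp [shift_apply, one_apply, eq_comm]

theorem skewLength_facts :
    (∀ i, skewLength (nonSimple i * nonSimple i) = 0) ∧
    nonSimple 2 * nonSimple 0 = nonSimple 0 * nonSimple 2 ∧
    ∀ i, i ≠ 1 → nonSimple i * (nonSimple 1 * nonSimple i) = nonSimple 1 * (nonSimple i * nonSimple 1)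
      ∧ skewLength (nonSimple 1 * nonSimple i) = 2 ∧ skewLength (nonSimple i * nonSimple 1) = 2 := by
  decide +kernel

theorem shift_rel ⦃x y : FreeAlgebra K (Fin 3)⦄ (h : GrRel K x y) :
    FreeAlgebra.lift K (fun i => shift K (nonSimple i)) x
      = FreeAlgebra.lift K (fun i => shift K (nonSimple i)) y := by
  obtain ⟨h1, h2, h3⟩ := skewLength_facts
  cases h with
  | sq i =>
    rw [map_mul, map_zero, FreeAlgebra.lift_ι_apply, shift_mul_shift, h1, skewLength_nonSimple,
      if_neg (by decide)]
  | comm =>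
    rw [map_mul, map_mul, FreeAlgebra.lift_ι_apply, FreeAlgebra.lift_ι_apply, shift_mul_shift,
      shift_mul_shift, h2, add_comm (skewLength _)]
  | braid i hi =>
    obtain ⟨h4, h5, h6⟩ := h3 i hi
    simp only [map_mul, FreeAlgebra.lift_ι_apply, shift_mul_shift, skewLength_nonSimple, h5, h6,
      if_true, h4]

/-- The presented algebra acts on the geodesic algebra by translation invariant elements. -/
noncomputable def presentedToPerm (K : Type*) [Field K] : PresentedAlgebra K →ₐ[K] PermAlgebra K :=
  RingQuot.liftAlgHom K ⟨FreeAlgebra.lift K fun i => shift K (nonSimple i), shift_rel⟩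

theorem presentedToPerm_gen (i : Fin 3) :
    presentedToPerm K (presentedGen K i) = shift K (nonSimple i) := by
  rw [presentedToPerm, presentedGen, RingQuot.liftAlgHom_mkAlgHom_apply, FreeAlgebra.lift_ι_apply]

theorem presentedToPerm_word (w : List (Fin 3)) :
    presentedToPerm K (w.map (presentedGen K)).prod =
      if skewLength (wordPerm w) = w.length then shift K (wordPerm w) else 0 := by
  induction w with
  | nil => rw [List.map_nil, List.prod_nil, map_one, wordPerm, shift_one, if_pos (by decide)]
  | cons i w ih =>
    have h1 := skewLength_mul_le (wordPerm w) (nonSimple i)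
    have h2 := skewLength_wordPerm_le w
    rw [skewLength_nonSimple] at h1
    rw [List.map_cons, List.prod_cons, map_mul, ih, presentedToPerm_gen, wordPerm, List.length_cons]
    by_cases h : skewLength (wordPerm w) = w.length
    · rw [if_pos h, shift_mul_shift, skewLength_nonSimple]
      refine if_congr ?_ rfl rfl
      omega
    · rw [if_neg h, mul_zero, if_neg (by omega)]

/-- The coefficients of the elements of the presented algebra. -/
noncomputable def presentedCoeff (K : Type*) [Field K] :
    PresentedAlgebra K →ₗ[K] (Equiv.Perm (Fin 4) → K) where
  toFun x w := presentedToPerm K x 1 w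
  map_add' x y := by ext w; rw [map_add]; rfl
  map_smul' c x := by ext w; rw [map_smul]; rfl

theorem presentedCoeff_word (w : List (Fin 3)) :
    presentedCoeff K (w.map (presentedGen K)).prod =
      if skewLength (wordPerm w) = w.length then Pi.single (wordPerm w) 1 else 0 := by
  ext v
  change presentedToPerm K (w.map (presentedGen K)).prod 1 v = _
  rw [presentedToPerm_word]
  split_ifs
  · rw [shift_apply, mul_one, Pi.single_apply]
  · rfl

/-- Reduced words map to the 24 coordinate vectors, and 24 elements span the source. -/
theorem presentedCoeff_bijective : Function.Bijective (presentedCoeff K) := by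
  obtain ⟨hfin, hle⟩ := (presentedAlgebra_spannedBy (K := K)).finrank_le
  have hs : Function.Surjective (presentedCoeff K) := by
    rw [← LinearMap.range_eq_top, eq_top_iff, ← (Pi.basisFun K (Equiv.Perm (Fin 4))).span_eq,
      Submodule.span_le]
    rintro _ ⟨w, rfl⟩
    refine ⟨((redWord w).map (presentedGen K)).prod, ?_⟩
    rw [presentedCoeff_word, wordPerm_redWord, length_redWord, if_pos rfl, Pi.basisFun_apply]
  have hge := LinearMap.finrank_le_finrank_of_surjective hs
  have hP : Module.finrank K (Equiv.Perm (Fin 4) → K) = 24 := by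
    rw [Module.finrank_fintype_fun_eq_card, Fintype.card_perm, Fintype.card_fin]
    rfl
  exact ⟨(LinearMap.injective_iff_surjective_of_finrank_eq_finrank (by omega)).2 hs, hs⟩

end Presented

/-! ### The associated graded module -/

section Graded

open GeodesicAlgebra

variable {K : Type*} [Field K] {α β : K} {hβ : β ^ 2 = α} {V : VertexSystem hβ}

/-- The class in `gr Γ_σ` of an element of the filtration. -/
noncomputable def grClass (V : VertexSystem hβ) (σ : Equiv.Perm (Fin 4)) (r : ℕ) :
    radFil V σ r →ₗ[K] GrGamma V σ :=
  DirectSum.lof K ℕ (GrPiece V σ) r ∘ₗ ((radFil V σ (r + 1)).submoduleOf (radFil V σ r)).mkQ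

theorem grClass_eq_of_sub_mem {σ : Equiv.Perm (Fin 4)} {r : ℕ} {x y : radFil V σ r}
    (h : (x - y : DFK K 4 α (-α)) ∈ radFil V σ (r + 1)) : grClass V σ r x = grClass V σ r y := by
  have : Submodule.Quotient.mk (p := (radFil V σ (r + 1)).submoduleOf (radFil V σ r)) x
      = Submodule.Quotient.mk y :=
    (Submodule.Quotient.eq _).2 (Submodule.mem_comap.2 h)
  exact congrArg (DirectSum.lof K ℕ (GrPiece V σ) r) this

theorem pathClass_eq (A : ArrowSystem V) (σ : Equiv.Perm (Fin 4)) {r : ℕ} (w : List (Fin 3))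
    (hr : w.length = r) (h : pathElem A σ w ∈ radFil V σ r) :
    pathClass A σ w = grClass V σ r ⟨pathElem A σ w, h⟩ := by
  subst hr
  rfl

variable (φ : DFK K 4 α (-α) ≃ₐ[K] PermAlgebra K) (hφ : ∀ σ, φ (V.e σ) = unit σ σ)

include hφ

/-- Left multiplication by E_{σσ} selects row σ, and the radical power bounds the distances from
below. -/
theorem mem_radFil_iff (σ : Equiv.Perm (Fin 4)) (r : ℕ) (x : DFK K 4 α (-α)) :
    x ∈ radFil V σ r ↔ φ x ∈ fil (K := K) (X := Equiv.Perm (Fin 4)) r ∧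
      ∀ ρ τ, ρ ≠ σ → φ x ρ τ = 0 := by
  constructor
  · rintro ⟨y, hy, rfl⟩
    have hy' : φ y ∈ fil (K := K) (X := Equiv.Perm (Fin 4)) r := (mem_jacobson_pow_iff φ r y).1 hy
    rw [LinearMap.mulLeft_apply, map_mul, hφ]
    refine ⟨?_, fun ρ τ h => by rw [unit_mul_apply, if_neg h]⟩
    simpa using mul_mem_fil (mem_fil_zero (unit σ σ)) hy'
  · rintro ⟨h1, h2⟩
    refine ⟨x, (mem_jacobson_pow_iff φ r x).2 h1, φ.injective ?_⟩
    rw [LinearMap.mulLeft_apply, map_mul, hφ]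
    ext ρ τ
    rw [unit_mul_apply]
    split_ifs with h
    · rw [h]
    · rw [h2 ρ τ h]

/-- The coefficients of the elements of a homogeneous component of `gr Γ_σ`. -/
noncomputable def pieceCoeff (σ : Equiv.Perm (Fin 4)) (r : ℕ) :
    GrPiece V σ r →ₗ[K] (Equiv.Perm (Fin 4) → K) :=
  Submodule.liftQ _
    { toFun := fun x w => if skewLength w = r then φ (x : DFK K 4 α (-α)) σ (w * σ) else 0
      map_add' := fun x y => by
        ext w
        simp only [Submodule.coe_add, map_add, GeodesicAlgebra.add_apply, Pi.add_apply]
        split_ifs <;> simp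
      map_smul' := fun c x => by
        ext w
        simp only [Submodule.coe_smul, map_smul, GeodesicAlgebra.smul_apply, Pi.smul_apply,
          RingHom.id_apply, smul_eq_mul]
        split_ifs <;> simp }
    (by
      intro x hx
      rw [LinearMap.mem_ker]
      ext w
      change (if _ then _ else _) = (0 : K)
      split_ifs with h
      · refine ((mem_radFil_iff φ hφ σ (r + 1) x).1 hx).1 _ _ ?_
        rw [d_perm, mul_inv_cancel_right]
        omega
      · rfl)

/-- The coefficients of the elements of `gr Γ_σ`. -/
noncomputable def grCoeff (σ : Equiv.Perm (Fin 4)) : GrGamma V σ →ₗ[K] (Equiv.Perm (Fin 4) → K) :=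
  DirectSum.toModule K ℕ _ (pieceCoeff φ hφ σ)

theorem grCoeff_grClass (σ : Equiv.Perm (Fin 4)) (r : ℕ) (x : radFil V σ r)
    (w : Equiv.Perm (Fin 4)) :
    grCoeff φ hφ σ (grClass V σ r x) w =
      if skewLength w = r then φ (x : DFK K 4 α (-α)) σ (w * σ) else 0 := by
  rw [grCoeff, grClass, LinearMap.comp_apply, DirectSum.toModule_lof]
  rfl

theorem grCoeff_pathClass (σ : Equiv.Perm (Fin 4)) (w : List (Fin 3)) :
    grCoeff φ hφ σ (pathClass (arrowSystem φ hφ) σ w) =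
      if skewLength (wordPerm w) = w.length then Pi.single (wordPerm w) 1 else 0 := by
  ext v
  rw [pathClass_eq _ _ _ rfl (pathElem_mem _ _ _), grCoeff_grClass]
  change (if _ then φ (pathElem (arrowSystem φ hφ) σ w) σ (v * σ) else 0) = _
  rw [map_pathElem]
  by_cases h : skewLength (wordPerm w) = w.length
  · rw [if_pos h, if_pos h, Pi.single_apply, unit_apply]
    by_cases hv : v = wordPerm w
    · subst hv
      simp [h]
    · simp [hv]
  · rw [if_neg h, if_neg h]
    simp

/-- The linear combinations of the classes of the chosen reduced paths. -/
noncomputable def grSpan (σ : Equiv.Perm (Fin 4)) : (Equiv.Perm (Fin 4) → K) →ₗ[K] GrGamma V σ :=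
  ∑ w, LinearMap.toSpanSingleton K (GrGamma V σ) (pathClass (arrowSystem φ hφ) σ (redWord w)) ∘ₗ
    LinearMap.proj w

theorem grSpan_apply (σ : Equiv.Perm (Fin 4)) (c : Equiv.Perm (Fin 4) → K) :
    grSpan φ hφ σ c = ∑ w, LinearMap.toSpanSingleton K (GrGamma V σ)
      (pathClass (arrowSystem φ hφ) σ (redWord w)) (c w) := by
  rw [grSpan, LinearMap.sum_apply]
  rfl

/-- In degree r, an element and the combination of reduced paths with its coefficients agree at
distance r, so they differ by an element of the next filtration step. -/
theorem grSpan_grCoeff (σ : Equiv.Perm (Fin 4)) (y : GrGamma V σ) :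
    grSpan φ hφ σ (grCoeff φ hφ σ y) = y := by
  induction y using DirectSum.induction_on with
  | zero => rw [map_zero, map_zero]
  | add x y hx hy => rw [map_add, map_add, hx, hy]
  | of r x =>
    obtain ⟨x, rfl⟩ := Submodule.Quotient.mk_surjective _ x
    change grSpan φ hφ σ (grCoeff φ hφ σ (grClass V σ r x)) = grClass V σ r x
    -- All summands are lifted to the same filtration step r. For w of another length the
    -- coefficient is 0, so p = 0 serves.
    have hp : ∀ w, ∃ p : radFil V σ r, ∀ c : K, (skewLength w ≠ r → c = 0) →
        LinearMap.toSpanSingleton K (GrGamma V σ)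
          (pathClass (arrowSystem φ hφ) σ (redWord w)) c = grClass V σ r (c • p) ∧
        φ ((c • p : radFil V σ r) : DFK K 4 α (-α)) = c • unit σ (w * σ) := by
      intro w
      by_cases hw : skewLength w = r
      · have hl : (redWord w).length = r := by rw [length_redWord, hw]
        refine ⟨⟨pathElem (arrowSystem φ hφ) σ (redWord w), hl ▸ pathElem_mem _ _ _⟩,
          fun c _ => ⟨?_, ?_⟩⟩
        · rw [map_smul, pathClass_eq _ _ _ hl]
          rfl
        · rw [Submodule.coe_smul, map_smul, map_pathElem, wordPerm_redWord, length_redWord,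
            if_pos rfl]
      · refine ⟨0, fun c hc => ?_⟩
        rw [hc hw, smul_zero, map_zero, map_zero]
        exact ⟨rfl, by simp⟩
    choose p hp using hp
    set c := grCoeff φ hφ σ (grClass V σ r x) with hc
    have hc0 : ∀ w, skewLength w ≠ r → c w = 0 := fun w hw => by
      rw [hc, grCoeff_grClass, if_neg hw]
    rw [grSpan_apply, Finset.sum_congr rfl fun w _ => (hp w (c w) (hc0 w)).1, ← map_sum]
    symm
    refine grClass_eq_of_sub_mem ((mem_radFil_iff φ hφ σ (r + 1) _).2 ?_)
    obtain ⟨hx1, hx2⟩ := (mem_radFil_iff φ hφ σ r x).1 x.2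
    have hsum : φ ((x : DFK K 4 α (-α)) - ((∑ w, c w • p w : radFil V σ r) : DFK K 4 α (-α)))
        = φ x - ∑ w, c w • unit σ (w * σ) := by
      rw [map_sub, AddSubmonoidClass.coe_finsetSum, map_sum,
        Finset.sum_congr rfl fun w _ => (hp w (c w) (hc0 w)).2]
    rw [hsum]
    have hcoef : ∀ τ, (∑ w, c w • unit σ (w * σ) : PermAlgebra K) σ τ = c (τ * σ⁻¹) := by
      intro τ
      rw [GeodesicAlgebra.sum_apply, Finset.sum_eq_single (τ * σ⁻¹)]
      · simp [unit_apply]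
      · intro w _ hw
        rw [GeodesicAlgebra.smul_apply, unit_apply, if_neg, mul_zero]
        rintro ⟨-, rfl⟩
        exact hw (by rw [mul_inv_cancel_right])
      · simp
    have hcoef' : ∀ ρ τ, ρ ≠ σ → (∑ w, c w • unit σ (w * σ) : PermAlgebra K) ρ τ = 0 := by
      intro ρ τ h
      rw [GeodesicAlgebra.sum_apply]
      refine Finset.sum_eq_zero fun w _ => ?_
      rw [GeodesicAlgebra.smul_apply, unit_apply, if_neg fun h' => h h'.1, mul_zero]
    constructor
    · intro ρ τ h
      rw [GeodesicAlgebra.sub_apply]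
      by_cases hρ : ρ = σ
      · subst hρ
        rw [hcoef, hc, grCoeff_grClass, inv_mul_cancel_right]
        rw [d_perm] at h
        split_ifs with h'
        · rw [sub_self]
        · rw [hx1 ρ τ (by rw [d_perm]; omega), sub_zero]
      · rw [hx2 ρ τ hρ, hcoef' ρ τ hρ, sub_zero]
    · intro ρ τ hρ
      rw [GeodesicAlgebra.sub_apply, hx2 ρ τ hρ, hcoef' ρ τ hρ, sub_zero]

theorem grCoeff_bijective (σ : Equiv.Perm (Fin 4)) :
    Function.Bijective (grCoeff φ hφ σ) := by
  constructor
  · intro x y h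
    rw [← grSpan_grCoeff φ hφ σ x, h, grSpan_grCoeff φ hφ σ y]
  · rw [← LinearMap.range_eq_top, eq_top_iff, ← (Pi.basisFun K (Equiv.Perm (Fin 4))).span_eq,
      Submodule.span_le]
    rintro _ ⟨w, rfl⟩
    refine ⟨pathClass (arrowSystem φ hφ) σ (redWord w), ?_⟩
    rw [grCoeff_pathClass, wordPerm_redWord, length_redWord, if_pos rfl, Pi.basisFun_apply]

/-- The presented algebra as the associated graded module. -/
noncomputable def presentedEquivGr (σ : Equiv.Perm (Fin 4)) :
    PresentedAlgebra K ≃ₗ[K] GrGamma V σ :=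
  (LinearEquiv.ofBijective _ presentedCoeff_bijective).trans
    (LinearEquiv.ofBijective _ (grCoeff_bijective φ hφ σ)).symm

theorem presentedEquivGr_word (σ : Equiv.Perm (Fin 4)) (w : List (Fin 3)) :
    presentedEquivGr φ hφ σ (w.map (presentedGen K)).prod = pathClass (arrowSystem φ hφ) σ w := by
  rw [presentedEquivGr, LinearEquiv.trans_apply, LinearEquiv.symm_apply_eq,
    LinearEquiv.ofBijective_apply, LinearEquiv.ofBijective_apply, grCoeff_pathClass,
    presentedCoeff_word]

/-- The product is transported along Ψ, which sends words to path classes because both have the same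
coordinates; concatenation is then respected automatically. -/
theorem exists_gr_mul (σ : Equiv.Perm (Fin 4)) :
    ∃ (mul : GrGamma V σ →ₗ[K] GrGamma V σ →ₗ[K] GrGamma V σ)
      (Ψ : PresentedAlgebra K ≃ₗ[K] GrGamma V σ),
      (∀ u v : List (Fin 3), mul (pathClass (arrowSystem φ hφ) σ u)
        (pathClass (arrowSystem φ hφ) σ v) = pathClass (arrowSystem φ hφ) σ (u ++ v)) ∧
      (∀ x y, Ψ (x * y) = mul (Ψ x) (Ψ y)) ∧
      (∀ w : List (Fin 3),
        Ψ ((w.map (presentedGen K)).prod) = pathClass (arrowSystem φ hφ) σ w) := by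
  set Ψ := presentedEquivGr φ hφ σ with hΨ
  have hmul : ∀ x y, Ψ (x * y) = ((LinearMap.mul K (PresentedAlgebra K)).compl₁₂
      (Ψ.symm : GrGamma V σ →ₗ[K] PresentedAlgebra K)
      (Ψ.symm : GrGamma V σ →ₗ[K] PresentedAlgebra K)).compr₂
      (Ψ : PresentedAlgebra K →ₗ[K] GrGamma V σ) (Ψ x) (Ψ y) := fun x y => by simp
  have hw : ∀ w : List (Fin 3),
      Ψ ((w.map (presentedGen K)).prod) = pathClass (arrowSystem φ hφ) σ w :=
    presentedEquivGr_word φ hφ σ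
  refine ⟨_, Ψ, fun u v => ?_, hmul, hw⟩
  rw [← hw, ← hw, ← hw, List.map_append, List.prod_append, hmul]

end Graded

/-! ### The nil-Coxeter algebra -/

section NilCoxeter

variable {K : Type*} [Field K]

theorem orderOf_simpleTransposition_mul (i j : Fin 3) :
    orderOf (simpleTransposition i * simpleTransposition j) =
      if i = j then 1 else if i = 1 ∨ j = 1 then 3 else 2 := by
  have h3 : ∀ i j : Fin 3, i ≠ j → (i = 1 ∨ j = 1) →
      (simpleTransposition i * simpleTransposition j) ^ 3 = 1 := by decide
  have h2 : ∀ i j : Fin 3, i ≠ j → ¬(i = 1 ∨ j = 1) →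
      (simpleTransposition i * simpleTransposition j) ^ 2 = 1 := by decide
  have h1 : ∀ i j : Fin 3, i ≠ j → simpleTransposition i * simpleTransposition j ≠ 1 := by decide
  split_ifs with h h'
  · subst h
    rw [orderOf_eq_one_iff, simpleTransposition, Equiv.swap_mul_self]
  · exact orderOf_eq_prime (h3 i j h h') (h1 i j h)
  · exact orderOf_eq_prime (h2 i j h h') (h1 i j h)

/-- The generators of the nil-Coxeter algebra of the symmetric group on four letters. -/
noncomputable def nilGen (K : Type*) [Field K] (i : Fin 3) :
    NilCoxeterAlgebra K simpleTransposition :=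
  RingQuot.mkAlgHom K _ (FreeAlgebra.ι K i)

theorem nilGen_sq (i : Fin 3) : nilGen K i * nilGen K i = 0 := by
  have := RingQuot.mkAlgHom_rel K (NilCoxeterRel.sq (K := K) (S := simpleTransposition) i)
  rwa [map_mul, map_zero] at this

theorem nilGen_braid (i j : Fin 3) :
    ((CoxeterSystem.alternatingWord i j
      (orderOf (simpleTransposition i * simpleTransposition j))).map (nilGen K)).prod =
    ((CoxeterSystem.alternatingWord j i
      (orderOf (simpleTransposition i * simpleTransposition j))).map (nilGen K)).prod := by
  have := RingQuot.mkAlgHom_rel K (NilCoxeterRel.braid (K := K) (S := simpleTransposition) i j)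
  rwa [map_list_prod, map_list_prod, List.map_map, List.map_map] at this

theorem lift_nilGen_rel ⦃x y : FreeAlgebra K (Fin 3)⦄ (h : GrRel K x y) :
    FreeAlgebra.lift K (nilGen K) x = FreeAlgebra.lift K (nilGen K) y := by
  cases h with
  | sq i => simp [nilGen_sq]
  | comm =>
    have := nilGen_braid (K := K) 0 2
    rw [orderOf_simpleTransposition_mul, if_neg (by decide), if_neg (by decide)] at this
    simpa [CoxeterSystem.alternatingWord] using this
  | braid i hi =>
    have := nilGen_braid (K := K) i 1
    rw [orderOf_simpleTransposition_mul, if_neg hi, if_pos (Or.inr rfl)] at this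
    -- `alternatingWord i 1 3` ends in its second letter, so it reads 1, i, 1; hence the two sides
    -- are exchanged.
    simpa [CoxeterSystem.alternatingWord, mul_assoc] using this.symm

theorem lift_presentedGen_rel ⦃x y : FreeAlgebra K (Fin 3)⦄
    (h : NilCoxeterRel K simpleTransposition x y) :
    FreeAlgebra.lift K (presentedGen K) x = FreeAlgebra.lift K (presentedGen K) y := by
  cases h with
  | sq i => simp [presentedGen_sq]
  | braid i j =>
    have h02 := presentedGen_comm (K := K)
    have h01 := presentedGen_braid (K := K) 0 (by decide)
    have h21 := presentedGen_braid (K := K) 2 (by decide)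
    rw [mul_assoc, mul_assoc] at h01 h21
    rw [map_list_prod, map_list_prod, List.map_map, List.map_map,
      orderOf_simpleTransposition_mul]
    fin_cases i <;> fin_cases j <;>
      simp [CoxeterSystem.alternatingWord, h02, h01, h21]

/-- The presented algebra is the nil-Coxeter algebra of the symmetric group on four letters. -/
noncomputable def presentedEquivNilCoxeter (K : Type*) [Field K] :
    PresentedAlgebra K ≃ₐ[K] NilCoxeterAlgebra K simpleTransposition :=
  AlgEquiv.ofAlgHom
    (RingQuot.liftAlgHom K ⟨FreeAlgebra.lift K (nilGen K), lift_nilGen_rel⟩)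
    (RingQuot.liftAlgHom K ⟨FreeAlgebra.lift K (presentedGen K), lift_presentedGen_rel⟩)
    (by
      refine RingQuot.ringQuot_ext' K _ _ (FreeAlgebra.hom_ext (funext fun i => ?_))
      simp [presentedGen, nilGen])
    (by
      refine RingQuot.ringQuot_ext' K _ _ (FreeAlgebra.hom_ext (funext fun i => ?_))
      simp [presentedGen, nilGen])

theorem presentedEquivNilCoxeter_gen (i : Fin 3) :
    presentedEquivNilCoxeter K (presentedGen K i) = RingQuot.mkAlgHom K _ (FreeAlgebra.ι K i) := by
  simp [presentedEquivNilCoxeter, presentedGen, nilGen]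

end NilCoxeter

theorem corollary2p12 {K : Type*} [Field K] [IsAlgClosed K] [CharZero K]
    {α β : K} (hα : α ≠ 0) (hβ : β ^ 2 = α) :
    Nonempty (VertexSystem hβ) ∧
    (∀ V : VertexSystem hβ, ∃ A : ArrowSystem V, ∀ σ : Equiv.Perm (Fin 4),
      ∃ (mul : GrGamma V σ →ₗ[K] GrGamma V σ →ₗ[K] GrGamma V σ)
        (Ψ : PresentedAlgebra K ≃ₗ[K] GrGamma V σ),
        (∀ u v : List (Fin 3),
          mul (pathClass A σ u) (pathClass A σ v) = pathClass A σ (u ++ v)) ∧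
        (∀ x y, Ψ (x * y) = mul (Ψ x) (Ψ y)) ∧
        (∀ w : List (Fin 3), Ψ ((w.map (presentedGen K)).prod) = pathClass A σ w)) ∧
    ∃ Φ : PresentedAlgebra K ≃ₐ[K] NilCoxeterAlgebra K simpleTransposition,
      ∀ i, Φ (presentedGen K i) = RingQuot.mkAlgHom K _ (FreeAlgebra.ι K i) := by
  refine ⟨nonempty_vertexSystem hα hβ, fun V => ?_,
    presentedEquivNilCoxeter K, presentedEquivNilCoxeter_gen⟩
  obtain ⟨φ, hφ⟩ := exists_equiv_vertexSystem hα V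
  exact ⟨arrowSystem φ hφ, exists_gr_mul φ hφ⟩
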